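/- **Setting.** Let $A$, $S$, $P$ be finite sets of applicants, supervisors and projects. Each applicant and each project has a strict preference list over its acceptable partners, each project $p$ has a capacity, each supervisor $s$ supervises a set $P_s\subseteq P$ of projects and has a budget $q_s$. Put $T=\{(s,p): s\in S,\ p\in P_s\}$ and $S_p=\{s : p\in P_s\}$. A matching $M\subseteq A\times P$ assigns each applicant to at most one project, uses only mutually acceptable pairs, and respects the capacities; $M(p)$ is the set of applicants matched to $p$. A feasible funding allocation for $M$ is a family $x=(x_{s,p})_{(s,p)\in T}$ of reals with $x_{s,p}\ge 0$, $\sum_{s\in S_p}x_{s,p}=|M(p)|$ for all $p\in P$, and $\sum_{p\in P_s}x_{s,p}\le q_s$ for all $s\in S$; $M$ is feasible if one exists. Let targets $0<t_{s,p}\le 1$ for $(s,p)\in T$ be given, with $\sum_{s\in S_p}t_{s,p}=1$ for every $p\in P$. A feasible funding allocation for $M$ is *egalitarian* if the weakly decreasing arrangement of its ratios $x_{s,p}/t_{s,p}$, $(s,p)\in T$, counted with multiplicity, is lexicographically smallest among those of all feasible funding allocations for $M$. **Algorithm.** The input is $T$, $(q_s)$, $(t_{s,p})$ and the numbers $|M(p)|$.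 Start with $T_{\rm tight}=\emptyset$. While $T_{\rm tight}\ne T$: (a) compute by a linear program the minimum $\lambda^*$ of $\lambda$ over all $(x,\lambda)$ such that $x$ is a feasible funding allocation, $x_{s,p}/t_{s,p}\le\lambda$ for $(s,p)\in T\setminus T_{\rm tight}$, and $x_{s,p}/t_{s,p}=\lambda_{s,p}$ for $(s,p)\in T_{\rm tight}$; (b) for each $(s,p)^*$ that was in $T\setminus T_{\rm tight}$ when (a) was executed, one after the other, compute by a linear program the maximum $\varepsilon^*$ of $\varepsilon$ over all $(x,\varepsilon)$ such that $x$ is a feasible funding allocation, $x_{s,p}/t_{s,p}\le\lambda^*$ for the pairs of the current $T\setminus T_{\rm tight}$ other than $(s,p)^*$, $x_{s,p}/t_{s,p}=\lambda_{s,p}$ for $(s,p)\in T_{\rm tight}$, and $x_{s,p}/t_{s,p}+\varepsilon\le\lambda^*$ for $(s,p)=(s,p)^*$; if $\varepsilon^*=0$, add $(s,p)^*$ to $T_{\rm tight}$ and set $\lambda_{(s,p)^*}=\lambda^*$. When the loop ends, return the allocation $x_{s,p}=\lambda_{s,p}t_{s,p}$. The linear programs are solved by an arbitrary linear programming algorithm,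 that is, a procedure that returns the optimal value of every linear program that has one. The size of a linear program is the number of its variables plus the number of its constraints plus the number of its nonzero coefficients. **Theorem.** There is an absolute constant $C$ such that the following holds for every such market, every feasible matching $M$ and all targets $t$. 1. For real data and any linear programming algorithm over $\mathbb R$, the algorithm terminates and returns the egalitarian funding allocation for $M$; in particular that allocation exists and is unique. It solves at most $C|S|^2|P|^2$ linear programs, each of size at most $C|S||P|$. If $S,P\neq\emptyset$ and every linear program of size $n$ is solved within time $LP(n)$, where $LP$ is nondecreasing and $LP(n)\ge n$, then the total running time, including the time for writing down the linear programs and all bookkeeping, with unit-cost arithmetic, is at most $C|S|^2|P|^2\cdot LP(C|S||P|)$. 2. For rational budgets and targets and any linear programming algorithm over $\mathbb Q$ that runs in time polynomial in the binary encoding length of the linear program, the algorithm again returns the egalitarian funding allocation (among all real allocations) and obeys the same bounds on the number and the size of the linear programs. It runs in polynomial time in the bit model: its total running time, elementary operations being charged by the binary lengths of the numbers involved, is bounded by a polynomial in the total binary encoding length of the numbers $q_s$, $|M(p)|$ and $t_{s,p}$, and that polynomial depends only on the polynomial that bounds the time of the linear programming algorithm. -/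

import Mathlib

/-! ### The summer internship model -/

/-- A summer internship market with applicants `A`, supervisors `S` and projects `P`.
A preference list ranks the acceptable partners, best first, so "acceptable" is membership in it. -/
structure Market (A S P : Type*) where
  applicantPref : A → List P
  applicantPref_nodup : ∀ a, (applicantPref a).Nodup
  projectPref : P → List A
  projectPref_nodup : ∀ p, (projectPref p).Nodup
  capacity : P → ℕ
  /-- The set `P_s` of projects supervised by `s`. -/
  projects : S → Finset P

namespace Market

variable {A S P K : Type*}

/-- The set `T` of all pairs `(s, p)` with `p ∈ P_s`. -/
abbrev Pair (G : Market A S P) : Type _ := Σ s : S, {p : P // p ∈ G.projects s}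

/-- The number `|M(p)|` of applicants matched to `p`. -/
def load [DecidableEq P] (M : Finset (A × P)) (p : P) : ℕ := (M.filter fun m => m.2 = p).card

/-- `M` is a matching. -/
structure IsMatching [DecidableEq A] [DecidableEq P]
    (G : Market A S P) (M : Finset (A × P)) : Prop where
  applicant_le_one : ∀ a, (M.filter fun m => m.1 = a).card ≤ 1
  applicant_acceptable : ∀ m ∈ M, m.2 ∈ G.applicantPref m.1
  project_le_capacity : ∀ p, load M p ≤ G.capacity p
  project_acceptable : ∀ m ∈ M, m.1 ∈ G.projectPref m.2

section Allocations

variable [Fintype S] [DecidableEq P] [Field K] [LinearOrder K]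

/-- `x` is a feasible funding allocation for the matching `M` when the supervisors have
the budgets `q`. -/
structure IsFeasibleAllocation (G : Market A S P) (q : S → K) (M : Finset (A × P))
    (x : G.Pair → K) : Prop where
  nonneg : ∀ e, 0 ≤ x e
  project_eq : ∀ p, ∑ e : G.Pair with e.2.1 = p, x e = (load M p : K)
  budget_le : ∀ s, ∑ p : {p : P // p ∈ G.projects s}, x ⟨s, p⟩ ≤ q s

/-- `M` is (supervisor-)feasible for the budgets `q`. -/
def IsFeasible (G : Market A S P) (q : S → K) (M : Finset (A × P)) : Prop :=
  ∃ x : G.Pair → K, G.IsFeasibleAllocation q M x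

/-- `t` is a family of normative targets: `0 < t_{s,p} ≤ 1`, and for every project the targets
of its supervisors sum to one. -/
structure IsTarget (G : Market A S P) (t : G.Pair → K) : Prop where
  pos : ∀ e, 0 < t e
  le_one : ∀ e, t e ≤ 1
  sum_eq_one : ∀ p, ∑ e : G.Pair with e.2.1 = p, t e = 1

/-- The weakly decreasing arrangement of the ratios `x_{s,p} / t_{s,p}`, with multiplicity. -/
noncomputable def ratioVector (G : Market A S P) (t x : G.Pair → K) : List K :=
  ((Finset.univ : Finset G.Pair).val.map fun e => x e / t e).sort (· ≥ ·)

/-- `x` is an egalitarian feasible funding allocation: its ratio vector is lexicographically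
smallest among those of all feasible funding allocations. -/
def IsEgalitarian (G : Market A S P) (q : S → K) (t : G.Pair → K) (M : Finset (A × P))
    (x : G.Pair → K) : Prop :=
  G.IsFeasibleAllocation q M x ∧
    ∀ y, G.IsFeasibleAllocation q M y →
      G.ratioVector t x = G.ratioVector t y ∨
        List.Lex (· < ·) (G.ratioVector t x) (G.ratioVector t y)

end Allocations

end Market

/-! ### Linear programs -/

/-- The relation sign of a linear constraint. -/
inductive LPRel
  | le
  | eq
  | ge

/-- The linear constraint `∑ i, coeff i * z i (≤, =, ≥) rhs` in variables indexed by `ι`. -/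
structure LPConstraint (K ι : Type*) where
  coeff : ι → K
  rel : LPRel
  rhs : K

/-- A linear program in variables indexed by `ι`; the variables are free unless constrained. -/
structure LinearProgram (K ι : Type*) where
  maximize : Bool
  objective : ι → K
  constraints : List (LPConstraint K ι)

/-- The assignment `z` satisfies the constraint. -/
def LPConstraint.Holds {K ι : Type*} [Fintype ι] [Field K] [LinearOrder K]
    (c : LPConstraint K ι) (z : ι → K) : Prop :=
  match c.rel with
  | .le => ∑ i, c.coeff i * z i ≤ c.rhs
  | .eq => ∑ i, c.coeff i * z i = c.rhs
  | .ge => c.rhs ≤ ∑ i, c.coeff i * z i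

namespace LinearProgram

variable {K ι : Type*} [Fintype ι]

section

variable [Field K] [LinearOrder K]

/-- The assignment `z` satisfies all constraints. -/
def IsFeasible (lp : LinearProgram K ι) (z : ι → K) : Prop :=
  ∀ c ∈ lp.constraints, c.Holds z

/-- The value of the objective function at `z`. -/
def value (lp : LinearProgram K ι) (z : ι → K) : K := ∑ i, lp.objective i * z i

/-- `v` is the optimal value of the program, attained at some feasible assignment. -/
def IsOptimalValue (lp : LinearProgram K ι) (v : K) : Prop :=
  ∃ z, lp.IsFeasible z ∧ lp.value z = v ∧
    ∀ z', lp.IsFeasible z' → if lp.maximize then lp.value z' ≤ v else v ≤ lp.value z'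

/-- The size of a program: the number of variables, plus the number of constraints, plus the
number of nonzero coefficients. -/
def size (lp : LinearProgram K ι) : ℕ :=
  Fintype.card ι + lp.constraints.length
    + (Finset.univ.filter fun i => lp.objective i ≠ 0).card
    + (lp.constraints.map fun c => (Finset.univ.filter fun i => c.coeff i ≠ 0).card).sum

end

end LinearProgram

/-- The binary encoding length of a rational number (sign, numerator, denominator). -/
def ratBits (a : ℚ) : ℕ := 1 + Nat.size a.num.natAbs + Nat.size a.den

/-- The binary encoding length of a rational linear program, all coefficients (also the
zero ones) being written out. -/
def LinearProgram.bitLength {ι : Type*} [Fintype ι] (lp : LinearProgram ℚ ι) : ℕ :=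
  1 + ∑ i, ratBits (lp.objective i)
    + (lp.constraints.map fun c => 2 + ∑ i, ratBits (c.coeff i) + ratBits c.rhs).sum

/-- An algorithm for linear programs over `K` in variables indexed by `ι`: the value that it
returns, and its running time, on every program. On a program that has an optimal value
it returns that value. -/
structure LPAlgorithm (K ι : Type*) [Fintype ι] [Field K] [LinearOrder K] where
  solve : LinearProgram K ι → K
  time : LinearProgram K ι → ℕ
  correct : ∀ lp v, lp.IsOptimalValue v → solve lp = v

/-! ### Cost models -/

/-- The prices of the elementary operations: `index` for handling the name of a variable
(reading, marking or testing one cell of a table), `num a` for copying the number `a`,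
and `program lp` for writing down the linear program `lp`. A product `a * b` is charged at
`num a * num b`. -/
structure CostModel (K ι : Type*) where
  index : ℕ
  num : K → ℕ
  program : LinearProgram K ι → ℕ

/-- Unit-cost arithmetic: one step for each elementary operation on numbers. -/
def arithmeticModel (K ι : Type*) [Fintype ι] [Field K] [LinearOrder K] : CostModel K ι where
  index := 1
  num _ := 1
  program lp := lp.size

/-- The bit model: operations on rational numbers are charged by binary length. -/
def bitModel (ι : Type*) [Fintype ι] : CostModel ℚ ι where
  index := Nat.size (Fintype.card ι)
  num := ratBits
  program lp := lp.bitLength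

/-! ### The algorithm -/

namespace Market

variable {A S P K : Type*}

/-- The variables of the linear programs: `some e` stands for `x_e`, and `none` stands for
the additional variable (`λ` or `ε`). -/
abbrev Var (G : Market A S P) : Type _ := Option G.Pair

section Algorithm

variable [Fintype S] [Fintype P] [DecidableEq S] [DecidableEq P] [Field K] [LinearOrder K]

/-- The constraint `c * x_e + d * (additional variable) (≤, =, ≥) r`. -/
def pairConstraint (G : Market A S P) (e : G.Pair) (c d : K) (rel : LPRel) (r : K) :
    LPConstraint K G.Var where
  coeff
    | some e' => if e' = e then c else 0
    | none => d
  rel := rel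
  rhs := r

/-- The constraints that describe the feasible funding allocations. -/
noncomputable def fundingConstraints (G : Market A S P) (q : S → K) (M : Finset (A × P)) :
    List (LPConstraint K G.Var) :=
  ((Finset.univ : Finset G.Pair).toList.map fun e => G.pairConstraint e 1 0 .ge 0) ++
  ((Finset.univ : Finset P).toList.map fun p =>
    { coeff := fun v => v.elim 0 fun e => if e.2.1 = p then 1 else 0
      rel := .eq
      rhs := (load M p : K) }) ++
  ((Finset.univ : Finset S).toList.map fun s =>
    { coeff := fun v => v.elim 0 fun e => if e.1 = s then 1 else 0
      rel := .le
      rhs := q s })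

/-- The linear program of the outer loop. The table `level` records the tight pairs: `e` is
tight with ratio `l` if `level e = some l`, and not tight if `level e = none`.
Minimise `λ` over the feasible funding allocations with `x_e / t_e ≤ λ` for the pairs that
are not tight and `x_e / t_e = l` for the tight ones. -/
noncomputable def mainLP (G : Market A S P) (q : S → K) (t : G.Pair → K) (M : Finset (A × P))
    (level : G.Pair → Option K) : LinearProgram K G.Var where
  maximize := false
  objective v := v.elim 1 fun _ => 0
  constraints := G.fundingConstraints q M ++
    (Finset.univ : Finset G.Pair).toList.map fun e =>
      match level e with
      | none => G.pairConstraint e (1 / t e) (-1) .le 0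
      | some l => G.pairConstraint e (1 / t e) 0 .eq l

/-- The auxiliary linear program for the pair `e₀`. Maximise `ε` over the feasible
funding allocations with `x_e / t_e ≤ lam` for the pairs `e ≠ e₀` that are not tight,
`x_e / t_e = l` for the tight ones, and `x_{e₀} / t_{e₀} + ε ≤ lam`. -/
noncomputable def auxLP (G : Market A S P) (q : S → K) (t : G.Pair → K) (M : Finset (A × P))
    (level : G.Pair → Option K) (lam : K) (e₀ : G.Pair) : LinearProgram K G.Var where
  maximize := true
  objective v := v.elim 1 fun _ => 0
  constraints := G.fundingConstraints q M ++
    (Finset.univ : Finset G.Pair).toList.map fun e =>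
      match level e with
      | none => G.pairConstraint e (1 / t e) (if e = e₀ then 1 else 0) .le lam
      | some l => G.pairConstraint e (1 / t e) 0 .eq l

/-- The state of a run: the table of tight pairs, the linear programs solved so far, and the
time used so far. -/
structure RunState (G : Market A S P) (K : Type*) where
  level : G.Pair → Option K
  solved : List (LinearProgram K G.Var)
  time : ℕ

/-- Spend `n` units of time. -/
def RunState.tick {G : Market A S P} (st : RunState G K) (n : ℕ) : RunState G K :=
  { st with time := st.time + n }

/-- Write down `lp` and run the linear programming algorithm on it. -/
def RunState.call {G : Market A S P} (cm : CostModel K G.Var) (alg : LPAlgorithm K G.Var)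
    (st : RunState G K) (lp : LinearProgram K G.Var) : RunState G K :=
  { st with
    solved := lp :: st.solved
    time := st.time + cm.program lp + alg.time lp }

/-- The body of the inner loop: solve the auxiliary program for `e`, test whether the optimal
value is zero, and if so declare `e` tight with ratio `lam`. -/
noncomputable def forBody (G : Market A S P) (cm : CostModel K G.Var) (alg : LPAlgorithm K G.Var)
    (q : S → K) (t : G.Pair → K) (M : Finset (A × P)) (lam : K)
    (st : RunState G K) (e : G.Pair) : RunState G K :=
  let lp := G.auxLP q t M st.level lam e
  let st₁ := (st.call cm alg lp).tick cm.index
  if alg.solve lp = 0 then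
    ({ st₁ with level := Function.update st₁.level e (some lam) }).tick (cm.index + cm.num lam)
  else st₁

/-- The body of the outer loop: solve the main program, then scan the table and run the inner
loop over all pairs that are not tight. -/
noncomputable def whileBody (G : Market A S P) (cm : CostModel K G.Var)
    (alg : LPAlgorithm K G.Var) (q : S → K) (t : G.Pair → K) (M : Finset (A × P))
    (st : RunState G K) : RunState G K :=
  let lp := G.mainLP q t M st.level
  let todo := (Finset.univ : Finset G.Pair).toList.filter fun e => (st.level e).isNone
  todo.foldl (G.forBody cm alg q t M (alg.solve lp))
    ((st.call cm alg lp).tick (Fintype.card G.Pair * cm.index))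

/-- The outer loop. It ends as soon as all pairs are tight, which is tested by a scan of the table;
the result is `none` if that does not happen within `n` iterations. -/
noncomputable def whileLoop (G : Market A S P) (cm : CostModel K G.Var)
    (alg : LPAlgorithm K G.Var) (q : S → K) (t : G.Pair → K) (M : Finset (A × P)) :
    ℕ → RunState G K → Option (RunState G K)
  | n, st =>
    let st₁ := st.tick ((Fintype.card G.Pair + 1) * cm.index)
    if ∀ e, (st.level e).isSome then some st₁
    else
      match n with
      | 0 => none
      | n + 1 => whileLoop G cm alg q t M n (G.whileBody cm alg q t M st₁)

/-- What a terminated run leaves: the funding allocation returned, the list of all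
linear programs solved, and the total time used. -/
structure RunResult (G : Market A S P) (K : Type*) where
  allocation : G.Pair → K
  solved : List (LinearProgram K G.Var)
  time : ℕ

/-- The algorithm, with at most `n` iterations of the outer loop: start with no
tight pair, run the outer loop, and return `x_e = λ_e * t_e`. -/
noncomputable def egalitarianAlgorithm (G : Market A S P) (cm : CostModel K G.Var)
    (alg : LPAlgorithm K G.Var) (q : S → K) (t : G.Pair → K) (M : Finset (A × P)) (n : ℕ) :
    Option (RunResult G K) :=
  (G.whileLoop cm alg q t M n
      { level := fun _ => none, solved := [], time := Fintype.card G.Pair * cm.index }).map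
    fun st =>
      { allocation := fun e => (st.level e).getD 0 * t e
        solved := st.solved
        time := st.time +
          ∑ e : G.Pair, (cm.index + cm.num ((st.level e).getD 0) * cm.num (t e)) }

/-- The algorithm, run without a bound on the number of iterations, terminates with result
`out`. -/
def TerminatesWith (G : Market A S P) (cm : CostModel K G.Var) (alg : LPAlgorithm K G.Var)
    (q : S → K) (t : G.Pair → K) (M : Finset (A × P)) (out : RunResult G K) : Prop :=
  ∃ n, G.egalitarianAlgorithm cm alg q t M n = some out

/-- The binary encoding length of the numbers given to the algorithm: the budgets, the numbers
`|M(p)|`, and the targets. -/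
def inputBits (G : Market A S P) (q : S → ℚ) (t : G.Pair → ℚ) (M : Finset (A × P)) : ℕ :=
  ∑ s, ratBits (q s) + ∑ p, ratBits (load M p) + ∑ e, ratBits (t e)

end Algorithm

end Market

/-!
The algorithm is analysed over the reals, for data in a field `K` (here `ℝ` or `ℚ`) read in `ℝ`
through an order embedding `φ`.

*Linear programs.* Fourier–Motzkin elimination produces from a system over `K` a description of its
projections that is valid over `K` and over `ℝ` alike. Hence a program over `K` that is feasible
and bounded over `ℝ` has an optimum in `K`, and that is also the real optimum
(`LPAlgorithm.isGreatest_solve`, `LPAlgorithm.isLeast_solve`). So an arbitrary algorithm over `K`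
must return the real optimal values.

*Correctness.* `Market.levelSet` consists of the feasible allocations that respect the ratios
recorded for the tight pairs, and `Market.cappedSet` of those that also keep the other pairs under a
cap. The main program returns the least possible cap `λ`. The auxiliary program of a pair has value
zero iff the pair has ratio `λ` in every allocation under the cap, so making the pair tight does not
change this set of allocations. Some pair becomes tight in each iteration, since otherwise
an average of allocations would stay strictly below `λ` (`Market.exists_forced_of_isLeast`). An
allocation that respects the current table but not the cap exceeds `λ` outside the tight pairs,
where the final allocation stays below `λ`, and so it is lexicographically worse
(`Market.lex_ratioVector_of_cap`). Induction over the iterations shows that the final allocation is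
strictly better than every other feasible one (`Market.exists_loopSpec`).

*Bit complexity.* Levels computed in one iteration are data of the programs of the next ones, so
their lengths have to be bounded by the length of the input alone. All of them are ratios of the
final allocation, and these are the unique solution of a linear system with coefficients from the
input: a direction in its kernel would allow a step that improves the allocation lexicographically
(`Market.direction_eq_zero`). Cramer's rule for the normal equations of the system
bounds their length (`ratBits_le_of_unique_solution`, `Market.ratBits_ratio_le`).
-/

/-! ### Lexicographic comparison of sorted families -/

/-- Inserting the same entry into two decreasing lists keeps their lexicographic order; sortedness
is not even needed. -/
theorem List.Lex.orderedInsert_ge {α : Type*} [LinearOrder α] (a : α) {l₁ l₂ : List α}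
    (h : List.Lex (· < ·) l₁ l₂) :
    List.Lex (· < ·) (l₁.orderedInsert (· ≥ ·) a) (l₂.orderedInsert (· ≥ ·) a) := by
  induction h with
  | @nil b l =>
    by_cases hab : a ≥ b
    · simp [List.orderedInsert_cons, hab]
    · simpa [List.orderedInsert_cons, hab] using List.Lex.rel (not_le.mp hab)
  | @cons c l₁ l₂ h ih =>
    by_cases hac : a ≥ c
    · simpa [List.orderedInsert_cons, hac] using h
    · simpa [List.orderedInsert_cons, hac] using ih
  | @rel b₁ l₁ b₂ l₂ hb =>
    by_cases h₂ : a ≥ b₂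
    · have h₁ : a ≥ b₁ := hb.le.trans h₂
      simpa [List.orderedInsert_cons, h₁, h₂] using List.Lex.rel hb
    · by_cases h₁ : a ≥ b₁
      · simpa [List.orderedInsert_cons, h₁, h₂] using List.Lex.rel (not_le.mp h₂)
      · simpa [List.orderedInsert_cons, h₁, h₂] using List.Lex.rel hb

theorem Multiset.sort_ge_cons {α : Type*} [LinearOrder α] (a : α) (X : Multiset α) :
    (a ::ₘ X).sort (· ≥ ·) = (X.sort (· ≥ ·)).orderedInsert (· ≥ ·) a := by
  refine List.Perm.eq_of_pairwise' (r := (· ≥ ·)) (Multiset.pairwise_sort _ _)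
    (List.Pairwise.orderedInsert a _ (Multiset.pairwise_sort _ _)) ?_
  refine List.Perm.trans ?_ (List.perm_orderedInsert _ _ _).symm
  rw [← Multiset.coe_eq_coe, ← Multiset.cons_coe, Multiset.sort_eq, Multiset.sort_eq]

theorem Multiset.lex_sort_add {α : Type*} [LinearOrder α] (D X Y : Multiset α) (μ : α)
    (hX : ∀ a ∈ X, a ≤ μ) (hY : ∃ b ∈ Y, μ < b) :
    List.Lex (· < ·) ((D + X).sort (· ≥ ·)) ((D + Y).sort (· ≥ ·)) := by
  induction D using Multiset.induction with
  | empty =>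
    rw [zero_add, zero_add]
    obtain ⟨b, hb, hμ⟩ := hY
    have hbs : b ∈ Y.sort (· ≥ ·) := (Multiset.mem_sort _).2 hb
    have hsort : (Y.sort (· ≥ ·)).Pairwise (· ≥ ·) := Multiset.pairwise_sort _ _
    have hXs : ∀ a ∈ X.sort (· ≥ ·), a ≤ μ := fun a ha => hX a ((Multiset.mem_sort _).1 ha)
    generalize X.sort (· ≥ ·) = l₁ at hXs
    generalize Y.sort (· ≥ ·) = l₂ at hbs hsort
    cases l₂ with
    | nil => simp at hbs
    | cons y l₂ =>
      have hy : μ < y := by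
        rcases List.mem_cons.1 hbs with rfl | h
        · exact hμ
        · exact hμ.trans_le (List.rel_of_pairwise_cons hsort h)
      cases l₁ with
      | nil => exact List.Lex.nil
      | cons x l₁ => exact List.Lex.rel ((hXs x (by simp)).trans_lt hy)
  | cons a D ih =>
    rw [Multiset.cons_add, Multiset.cons_add, Multiset.sort_ge_cons, Multiset.sort_ge_cons]
    exact ih.orderedInsert_ge a

/-- If `f` and `g` agree on `s`, and off `s` all values of `f` stay below a threshold that `g`
exceeds, then the decreasing arrangement of `f` is lexicographically smaller. -/
theorem lex_sort_map_of_threshold {ι α : Type*} [Fintype ι] [LinearOrder α] (f g : ι → α)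
    (s : Set ι) (μ : α) (hs : ∀ i ∈ s, f i = g i) (hf : ∀ i ∉ s, f i ≤ μ)
    (hg : ∃ i ∉ s, μ < g i) :
    List.Lex (· < ·) (((Finset.univ : Finset ι).val.map f).sort (· ≥ ·))
      (((Finset.univ : Finset ι).val.map g).sort (· ≥ ·)) := by
  classical
  have hsplit : ∀ h : ι → α, (Finset.univ : Finset ι).val.map h =
      ((Finset.univ : Finset ι).val.filter (· ∈ s)).map h +
        ((Finset.univ : Finset ι).val.filter (· ∉ s)).map h := by
    intro h
    rw [← Multiset.map_add, Multiset.filter_add_not]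
  rw [hsplit f, hsplit g, Multiset.map_congr rfl (g := g) (f := f)]
  · apply Multiset.lex_sort_add _ _ _ μ
    · intro a ha
      obtain ⟨i, hi, rfl⟩ := Multiset.mem_map.1 ha
      exact hf i (Multiset.mem_filter.1 hi).2
    · obtain ⟨i, hi, hlt⟩ := hg
      exact ⟨g i, Multiset.mem_map.2 ⟨i, Multiset.mem_filter.2 ⟨Finset.mem_univ i, hi⟩, rfl⟩, hlt⟩
  · intro i hi
    exact hs i (Multiset.mem_filter.1 hi).2

/-! ### Fourier–Motzkin elimination over a subfield -/

section FourierMotzkin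

variable {ι K L : Type*}

/-- The vector `z` over `L` satisfies the system `R` of inequalities `∑ j, a j * z j ≤ b`, the
pairs `(a, b)` being taken over `K` and read in `L` through `φ`. -/
def RowsHold [Fintype ι] [Field K] [Field L] [LinearOrder L] (φ : K →+* L) (R : Set ((ι → K) × K))
    (z : ι → L) : Prop :=
  ∀ r ∈ R, ∑ j, φ (r.1 j) * z j ≤ φ r.2

/-- One variable can be chosen to satisfy finitely many inequalities iff each lower bound for it
is at most each upper bound, and the inequalities without it hold. -/
theorem exists_forall_mul_le_iff [Field L] [LinearOrder L] [IsStrictOrderedRing L] {ρ : Type*}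
    {R : Set ρ} (hR : R.Finite) (a b : ρ → L) :
    (∃ t, ∀ r ∈ R, a r * t ≤ b r) ↔
      (∀ r ∈ R, a r = 0 → 0 ≤ b r) ∧
        ∀ r ∈ R, ∀ r' ∈ R, 0 < a r → a r' < 0 → a r' * b r ≤ a r * b r' := by
  constructor
  · rintro ⟨t, ht⟩
    refine ⟨fun r hr h0 => by simpa [h0] using ht r hr, fun r hr r' hr' hp hn => ?_⟩
    have h₁ := mul_le_mul_of_nonpos_left (ht r hr) hn.le
    have h₂ := mul_le_mul_of_nonneg_left (ht r' hr') hp.le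
    calc a r' * b r ≤ a r' * (a r * t) := h₁
      _ = a r * (a r' * t) := by ring
      _ ≤ a r * b r' := h₂
  · rintro ⟨h0, hpn⟩
    have key : ∀ r ∈ R, ∀ r' ∈ R, 0 < a r → a r' < 0 → b r' / a r' ≤ b r / a r := by
      intro r hr r' hr' hp hn
      rw [div_le_iff_of_neg hn, div_mul_eq_mul_div, div_le_iff₀ hp]
      nlinarith [hpn r hr r' hr' hp hn]
    have bound : ∀ t, (∀ r ∈ R, 0 < a r → t ≤ b r / a r) → (∀ r ∈ R, a r < 0 → b r / a r ≤ t) →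
        ∀ r ∈ R, a r * t ≤ b r := by
      intro t hu hl r hr
      rcases lt_trichotomy (a r) 0 with h | h | h
      · have := (div_le_iff_of_neg h).1 (hl r hr h)
        linarith [mul_comm t (a r)]
      · simpa [h] using h0 r hr h
      · have := (le_div_iff₀ h).1 (hu r hr h)
        linarith [mul_comm t (a r)]
    by_cases hneg : ∃ r ∈ R, a r < 0
    · obtain ⟨r₀, hr₀, hmax⟩ := Set.exists_max_image {r ∈ R | a r < 0} (fun r => b r / a r)
        (hR.subset fun _ h => h.1) (by obtain ⟨r, hr⟩ := hneg; exact ⟨r, hr⟩)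
      exact ⟨_, bound (b r₀ / a r₀) (fun r hr hp => key r hr r₀ hr₀.1 hp hr₀.2)
        fun r hr hn => hmax r ⟨hr, hn⟩⟩
    · push Not at hneg
      by_cases hpos : ∃ r ∈ R, 0 < a r
      · obtain ⟨r₀, hr₀, hmin⟩ := Set.exists_min_image {r ∈ R | 0 < a r} (fun r => b r / a r)
          (hR.subset fun _ h => h.1) (by obtain ⟨r, hr⟩ := hpos; exact ⟨r, hr⟩)
        exact ⟨_, bound (b r₀ / a r₀) (fun r hr hp => hmin r ⟨hr, hp⟩)
          fun r hr hn => absurd hn (hneg r hr).not_gt⟩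
      · push Not at hpos
        exact ⟨0, bound 0 (fun r hr hp => absurd hp (hpos r hr).not_gt)
          fun r hr hn => absurd hn (hneg r hr).not_gt⟩

/-- The system obtained from `R` by eliminating the variable `i`: keep the rows without `i`, and
combine each row with positive coefficient of `i` with each one with negative coefficient. -/
def eliminate [Field K] [LinearOrder K] (i : ι) (R : Set ((ι → K) × K)) : Set ((ι → K) × K) :=
  {r ∈ R | r.1 i = 0} ∪
    Set.image2 (fun r r' =>
      (fun j => r'.1 i * -r.1 j + r.1 i * r'.1 j, r.1 i * r'.2 - r'.1 i * r.2))
      {r ∈ R | 0 < r.1 i} {r ∈ R | r.1 i < 0}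

theorem finite_eliminate [Field K] [LinearOrder K] (i : ι) {R : Set ((ι → K) × K)}
    (hR : R.Finite) : (eliminate i R).Finite :=
  (hR.subset fun _ h => h.1).union
    (Set.Finite.image2 _ (hR.subset fun _ h => h.1) (hR.subset fun _ h => h.1))

theorem rowsHold_eliminate_iff [Fintype ι] [DecidableEq ι] [Field K] [LinearOrder K]
    [IsStrictOrderedRing K] [Field L] [LinearOrder L] [IsStrictOrderedRing L] {φ : K →+* L}
    (hφ : StrictMono φ) (i : ι) {R : Set ((ι → K) × K)} (hR : R.Finite) (w : ι → L) :
    (∃ t, RowsHold φ R (Function.update w i t)) ↔ RowsHold φ (eliminate i R) w := by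
  have hsum : ∀ (a : ι → K) (t : L), ∑ j, φ (a j) * Function.update w i t j =
      φ (a i) * t + (∑ j, φ (a j) * w j - φ (a i) * w i) := by
    intro a t
    rw [← Finset.add_sum_erase _ _ (Finset.mem_univ i),
      ← Finset.add_sum_erase (a := i) Finset.univ (fun j => φ (a j) * w j) (Finset.mem_univ i),
      Function.update_self, add_sub_cancel_left]
    congr 1
    refine Finset.sum_congr rfl fun j hj => ?_
    rw [Function.update_of_ne (Finset.ne_of_mem_erase hj)]
  have hpos : ∀ a : K, 0 < φ a ↔ 0 < a := fun a => by rw [← map_zero φ, hφ.lt_iff_lt]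
  have hneg : ∀ a : K, φ a < 0 ↔ a < 0 := fun a => by rw [← map_zero φ, hφ.lt_iff_lt]
  have hrow : (∃ t, RowsHold φ R (Function.update w i t)) ↔ ∃ t, ∀ r ∈ R, φ (r.1 i) * t ≤
      φ r.2 - (∑ j, φ (r.1 j) * w j - φ (r.1 i) * w i) := by
    refine exists_congr fun t => forall₂_congr fun r _ => ?_
    rw [hsum, le_sub_iff_add_le]
  rw [hrow, exists_forall_mul_le_iff hR]
  have hcomb : ∀ r r' : (ι → K) × K,
      (∑ j, φ (r'.1 i * -r.1 j + r.1 i * r'.1 j) * w j ≤ φ (r.1 i * r'.2 - r'.1 i * r.2)) ↔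
      φ (r'.1 i) * (φ r.2 - (∑ j, φ (r.1 j) * w j - φ (r.1 i) * w i)) ≤
        φ (r.1 i) * (φ r'.2 - (∑ j, φ (r'.1 j) * w j - φ (r'.1 i) * w i)) := by
    intro r r'
    have : ∑ j, φ (r'.1 i * -r.1 j + r.1 i * r'.1 j) * w j =
        -φ (r'.1 i) * ∑ j, φ (r.1 j) * w j + φ (r.1 i) * ∑ j, φ (r'.1 j) * w j := by
      rw [Finset.mul_sum, Finset.mul_sum, ← Finset.sum_add_distrib]
      refine Finset.sum_congr rfl fun j _ => ?_
      simp only [map_add, map_mul, map_neg]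
      ring
    rw [this]
    simp only [map_sub, map_mul]
    constructor <;> intro h <;> linarith
  constructor
  · rintro ⟨h0, hpn⟩ r (⟨hr, hri⟩ | ⟨r, ⟨hr, hp⟩, r', ⟨hr', hn⟩, rfl⟩)
    · have := h0 r hr (by rw [hri, map_zero])
      rw [hri, map_zero, zero_mul, sub_zero] at this
      linarith
    · exact (hcomb r r').2 (hpn r hr r' hr' ((hpos _).2 hp) ((hneg _).2 hn))
  · intro h
    refine ⟨fun r hr h0 => ?_, fun r hr r' hr' hp hn => ?_⟩
    · have := h r (Or.inl ⟨hr, φ.injective (by rw [h0, map_zero])⟩)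
      rw [h0, zero_mul, sub_zero]
      linarith
    · exact (hcomb r r').1 (h _ (Or.inr
        ⟨r, ⟨hr, (hpos _).1 hp⟩, r', ⟨hr', (hneg _).1 hn⟩, rfl⟩))

theorem exists_eq_off_insert_iff [DecidableEq ι] {s : Finset ι} {i : ι} (Q : (ι → L) → Prop)
    (w : ι → L) : (∃ z, (∀ j ∉ insert i s, z j = w j) ∧ Q z) ↔
      ∃ t, ∃ z, (∀ j ∉ s, z j = Function.update w i t j) ∧ Q z := by
  constructor
  · rintro ⟨z, hz, h⟩
    refine ⟨z i, z, fun j hj => ?_, h⟩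
    by_cases hji : j = i
    · subst hji; simp
    · simpa [hji] using hz j (by simp [hji, hj])
  · rintro ⟨t, z, hz, h⟩
    refine ⟨z, fun j hj => ?_, h⟩
    simp only [Finset.mem_insert, not_or] at hj
    simpa [hj.1] using hz j hj.2

theorem exists_eq_off_empty_iff (Q : (ι → L) → Prop) (w : ι → L) :
    (∃ z, (∀ i ∉ (∅ : Finset ι), z i = w i) ∧ Q z) ↔ Q w := by
  refine ⟨?_, fun h => ⟨w, fun _ _ => rfl, h⟩⟩
  rintro ⟨z, hz, hQ⟩
  rwa [← show z = w from funext fun i => hz i (Finset.notMem_empty i)]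

/-- The projection of a polyhedron along the coordinates in `s` is described by a system that
does not depend on the field over which solutions are sought. -/
theorem exists_rows_projection [Fintype ι] [Field K] [LinearOrder K] [IsStrictOrderedRing K]
    [Field L] [LinearOrder L] [IsStrictOrderedRing L] {φ : K →+* L} (hφ : StrictMono φ)
    (s : Finset ι) {R : Set ((ι → K) × K)} (hR : R.Finite) :
    ∃ R' : Set ((ι → K) × K), R'.Finite ∧
      (∀ w : ι → K, (∃ z, (∀ i ∉ s, z i = w i) ∧ RowsHold (RingHom.id K) R z) ↔
        RowsHold (RingHom.id K) R' w) ∧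
      (∀ w : ι → L, (∃ z, (∀ i ∉ s, z i = w i) ∧ RowsHold φ R z) ↔ RowsHold φ R' w) := by
  classical
  induction s using Finset.induction_on with
  | empty => exact ⟨R, hR, exists_eq_off_empty_iff _, exists_eq_off_empty_iff _⟩
  | insert i s hi ih =>
    obtain ⟨R', hR', hK, hL⟩ := ih
    refine ⟨eliminate i R', finite_eliminate i hR', fun w => ?_, fun w => ?_⟩
    · rw [exists_eq_off_insert_iff,
        ← rowsHold_eliminate_iff (φ := RingHom.id K) strictMono_id i hR']
      exact exists_congr fun t => hK _
    · rw [exists_eq_off_insert_iff, ← rowsHold_eliminate_iff hφ i hR']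
      exact exists_congr fun t => hL _

theorem rowsHold_update_zero_iff [Fintype ι] [DecidableEq ι] [Field K] [Field L] [LinearOrder L]
    (φ : K →+* L) (R : Set ((ι → K) × K)) (i : ι) (v : L) :
    RowsHold φ R (Function.update 0 i v) ↔ ∀ r ∈ R, φ (r.1 i) * v ≤ φ r.2 := by
  refine forall₂_congr fun r _ => ?_
  rw [Finset.sum_eq_single i (fun j _ hj => by simp [hj]) (by simp), Function.update_self]

/-- A coordinate that is bounded above on a nonempty polyhedron with coefficients in `K`, both
over the larger field `L`, attains its maximum, and it does so at a point over `K`. -/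
theorem exists_max_coordinate [Fintype ι] [Field K] [LinearOrder K] [IsStrictOrderedRing K]
    [Field L] [LinearOrder L] [IsStrictOrderedRing L] {φ : K →+* L} (hφ : StrictMono φ) (i : ι)
    {R : Set ((ι → K) × K)} (hR : R.Finite) (hne : ∃ z : ι → L, RowsHold φ R z) (B : L)
    (hB : ∀ z : ι → L, RowsHold φ R z → z i ≤ B) :
    ∃ z : ι → K, RowsHold (RingHom.id K) R z ∧ ∀ y : ι → L, RowsHold φ R y → y i ≤ φ (z i) := by
  classical
  obtain ⟨R', hR', hK, hL⟩ := exists_rows_projection hφ (Finset.univ.erase i) hR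
  have hK' : ∀ v : K, (∃ z : ι → K, z i = v ∧ RowsHold (RingHom.id K) R z) ↔
      ∀ r ∈ R', r.1 i * v ≤ r.2 := by
    intro v
    simpa using (hK (Function.update 0 i v)).trans (rowsHold_update_zero_iff _ _ _ _)
  have hL' : ∀ v : L, (∃ z : ι → L, z i = v ∧ RowsHold φ R z) ↔
      ∀ r ∈ R', φ (r.1 i) * v ≤ φ r.2 := by
    intro v
    simpa using (hL (Function.update 0 i v)).trans (rowsHold_update_zero_iff _ _ _ _)
  have hpos : ∀ a : K, 0 < φ a ↔ 0 < a := fun a => by rw [← map_zero φ, hφ.lt_iff_lt]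
  obtain ⟨z₀, hz₀⟩ := hne
  have hz₀' := (hL' (z₀ i)).1 ⟨z₀, rfl, hz₀⟩
  -- if no row bounded the coordinate from above, it could be pushed beyond `B`
  have hex : ∃ r ∈ R', 0 < r.1 i := by
    by_contra! hno
    obtain ⟨z, hz, h⟩ := (hL' (max (z₀ i) (B + 1))).2 fun r hr =>
      (mul_le_mul_of_nonpos_left (le_max_left _ _)
        (not_lt.1 fun h => (hno r hr).not_gt ((hpos _).1 h))).trans (hz₀' r hr)
    have := hB z h
    rw [hz] at this
    linarith [le_max_right (z₀ i) (B + 1)]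
  obtain ⟨r₀, ⟨hr₀, hp₀⟩, hmin⟩ := Set.exists_min_image {r ∈ R' | 0 < r.1 i}
    (fun r => r.2 / r.1 i) (hR'.subset fun _ h => h.1) hex
  have hle : ∀ y : ι → L, RowsHold φ R y → y i ≤ φ (r₀.2 / r₀.1 i) := by
    intro y hy
    have := (hL' (y i)).1 ⟨y, rfl, hy⟩ r₀ hr₀
    rw [map_div₀, le_div_iff₀ ((hpos _).2 hp₀)]
    linarith [mul_comm (y i) (φ (r₀.1 i))]
  obtain ⟨z, hz, h⟩ := (hK' (r₀.2 / r₀.1 i)).2 fun r hr => by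
    by_cases hp : 0 < r.1 i
    · have := hmin r ⟨hr, hp⟩
      rw [le_div_iff₀ hp] at this
      linarith [mul_comm (r₀.2 / r₀.1 i) (r.1 i)]
    · rw [← hφ.le_iff_le, map_mul]
      exact (mul_le_mul_of_nonpos_left (hle z₀ hz₀)
        (not_lt.1 fun h => hp ((hpos _).1 h))).trans (hz₀' r hr)
  exact ⟨z, h, fun y hy => hz ▸ hle y hy⟩

end FourierMotzkin

/-! ### Linear programs over a subfield of the reals -/

namespace LPConstraint

variable {ι K L : Type*}

/-- The constraint `c` with its coefficients read in another field through `φ`. -/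
def map (φ : K → L) (c : LPConstraint K ι) : LPConstraint L ι where
  coeff i := φ (c.coeff i)
  rel := c.rel
  rhs := φ c.rhs

/-- The inequalities of the form `∑ i, a i * z i ≤ b` that make up a constraint. -/
def rows [Field K] (c : LPConstraint K ι) : Set ((ι → K) × K) :=
  match c.rel with
  | .le => {(c.coeff, c.rhs)}
  | .eq => {(c.coeff, c.rhs), (fun i => -c.coeff i, -c.rhs)}
  | .ge => {(fun i => -c.coeff i, -c.rhs)}

theorem finite_rows [Field K] (c : LPConstraint K ι) : c.rows.Finite := by
  unfold rows
  split <;> simp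

theorem rowsHold_rows_iff [Fintype ι] [Field K] [Field L] [LinearOrder L] [IsStrictOrderedRing L]
    (φ : K →+* L) (c : LPConstraint K ι) (z : ι → L) :
    RowsHold φ c.rows z ↔ (c.map φ).Holds z := by
  obtain ⟨a, rel, b⟩ := c
  cases rel <;> simp [RowsHold, rows, map, Holds, le_antisymm_iff]

end LPConstraint

namespace LPAlgorithm

variable {ι K L : Type*}

theorem rowsHold_iUnion_rows_iff [Fintype ι] [Field K] [Field L] [LinearOrder L]
    [IsStrictOrderedRing L] (φ : K →+* L) (l : List (LPConstraint K ι)) (z : ι → L) :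
    RowsHold φ (⋃ c ∈ {c | c ∈ l}, c.rows) z ↔ ∀ c ∈ l, (c.map φ).Holds z := by
  simp only [← LPConstraint.rowsHold_rows_iff]
  simp only [RowsHold, Set.mem_iUnion, Set.mem_ofPred_eq, exists_prop]
  exact ⟨fun h c hc r hr => h r ⟨c, hc, hr⟩, fun h r ⟨c, hc, hr⟩ => h c hc r hr⟩

theorem finite_iUnion_rows [Field K] (l : List (LPConstraint K ι)) :
    (⋃ c ∈ {c | c ∈ l}, c.rows).Finite :=
  Set.Finite.biUnion (List.finite_toSet l) fun c _ => c.finite_rows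

variable [Fintype ι] [Field K] [LinearOrder K] [IsStrictOrderedRing K]
  [Field L] [LinearOrder L] [IsStrictOrderedRing L] {φ : K →+* L}

/-- On a program over `K` that maximizes one variable and is feasible and bounded over the larger
field `L`, an algorithm over `K` returns the maximum over `L`. -/
theorem isGreatest_solve (alg : LPAlgorithm K ι) (hφ : StrictMono φ) (lp : LinearProgram K ι)
    (i : ι) (hobj : ∀ z, lp.value z = z i) (hmax : lp.maximize = true)
    (hne : ∃ z : ι → L, ∀ c ∈ lp.constraints, (c.map φ).Holds z) (B : L)
    (hB : ∀ z : ι → L, (∀ c ∈ lp.constraints, (c.map φ).Holds z) → z i ≤ B) :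
    IsGreatest {v | ∃ z : ι → L, (∀ c ∈ lp.constraints, (c.map φ).Holds z) ∧ z i = v}
      (φ (alg.solve lp)) := by
  simp only [← rowsHold_iUnion_rows_iff] at hne hB ⊢
  obtain ⟨z, hz, hle⟩ := exists_max_coordinate hφ i (finite_iUnion_rows lp.constraints) hne B hB
  have hsolve : alg.solve lp = z i := by
    refine alg.correct lp _ ⟨z, (rowsHold_iUnion_rows_iff _ _ _).1 hz, hobj z, fun y hy => ?_⟩
    rw [if_pos hmax, hobj, ← hφ.le_iff_le]
    refine hle (fun j => φ (y j)) ?_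
    have := (rowsHold_iUnion_rows_iff (RingHom.id K) lp.constraints y).2 hy
    intro r hr
    have := hφ.monotone (this r hr)
    simpa using this
  rw [hsolve]
  refine ⟨⟨fun j => φ (z j), fun r hr => ?_, rfl⟩, ?_⟩
  · simpa using hφ.monotone (hz r hr)
  · rintro v ⟨y, hy, rfl⟩
    exact hle y hy

/-- The analogue of `LPAlgorithm.isGreatest_solve` for minimization. -/
theorem isLeast_solve (alg : LPAlgorithm K ι) (hφ : StrictMono φ) (lp : LinearProgram K ι)
    (i : ι) (hobj : ∀ z, lp.value z = z i) (hmax : lp.maximize = false)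
    (hne : ∃ z : ι → L, ∀ c ∈ lp.constraints, (c.map φ).Holds z) (B : L)
    (hB : ∀ z : ι → L, (∀ c ∈ lp.constraints, (c.map φ).Holds z) → B ≤ z i) :
    IsLeast {v | ∃ z : ι → L, (∀ c ∈ lp.constraints, (c.map φ).Holds z) ∧ z i = v}
      (φ (alg.solve lp)) := by
  simp only [← rowsHold_iUnion_rows_iff] at hne hB ⊢
  set R := ⋃ c ∈ {c | c ∈ lp.constraints}, c.rows with hR
  -- the reflected polyhedron
  let N : Set ((ι → K) × K) := (fun r => (-r.1, r.2)) '' R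
  have hN : ∀ z : ι → L, RowsHold φ N z ↔ RowsHold φ R (-z) := by
    intro z; simp only [N, RowsHold, Set.forall_mem_image]; simp
  have hNK : ∀ z : ι → K, RowsHold (RingHom.id K) N z ↔ RowsHold (RingHom.id K) R (-z) := by
    intro z; simp only [N, RowsHold, Set.forall_mem_image]; simp
  obtain ⟨z, hz, hle⟩ := exists_max_coordinate (R := N) hφ i
    ((finite_iUnion_rows lp.constraints).image _)
    (by obtain ⟨z, hz⟩ := hne; exact ⟨-z, (hN _).2 (by rwa [neg_neg])⟩) (-B)
    (fun z hz => by have := hB _ ((hN z).1 hz); simp only [Pi.neg_apply] at this; linarith)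
  have hle' : ∀ y, RowsHold φ R y → φ ((-z) i) ≤ y i := by
    intro y hy
    have := hle (-y) ((hN _).2 (by rwa [neg_neg]))
    simp only [Pi.neg_apply, map_neg] at this ⊢
    linarith
  rw [hNK] at hz
  have hsolve : alg.solve lp = (-z) i := by
    refine alg.correct lp _ ⟨-z, (rowsHold_iUnion_rows_iff _ _ _).1 hz, hobj _, fun y hy => ?_⟩
    rw [if_neg (by simp [hmax]), hobj, ← hφ.le_iff_le]
    refine hle' (fun j => φ (y j)) ?_
    have := (rowsHold_iUnion_rows_iff (RingHom.id K) lp.constraints y).2 hy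
    intro r hr
    have := hφ.monotone (this r hr)
    simpa using this
  rw [hsolve]
  refine ⟨⟨fun j => φ ((-z) j), fun r hr => ?_, rfl⟩, ?_⟩
  · simpa using hφ.monotone (hz r hr)
  · rintro v ⟨y, hy, rfl⟩
    exact hle' y hy

end LPAlgorithm

/-! ### What the linear programs of the algorithm compute -/

namespace Market

variable {A S P K : Type*} [Fintype S] [DecidableEq P]

/-- The real feasible funding allocations in which the tight pairs have their recorded ratios. The
data are given over `K` and read in `ℝ` through `φ`. -/
def levelSet [Field K] (φ : K →+* ℝ) (G : Market A S P) (q : S → K) (t : G.Pair → K)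
    (M : Finset (A × P)) (level : G.Pair → Option K) : Set (G.Pair → ℝ) :=
  {x | G.IsFeasibleAllocation (fun s => φ (q s)) M x ∧
    ∀ e l, level e = some l → x e / φ (t e) = φ l}

/-- The allocations in `levelSet` in which no pair that is not tight has a ratio above `lam`. -/
def cappedSet [Field K] (φ : K →+* ℝ) (G : Market A S P) (q : S → K) (t : G.Pair → K)
    (M : Finset (A × P)) (level : G.Pair → Option K) (lam : ℝ) : Set (G.Pair → ℝ) :=
  {x | x ∈ G.levelSet φ q t M level ∧ ∀ e, level e = none → x e / φ (t e) ≤ lam}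

section Programs

variable [DecidableEq S] [Field K] {φ : K →+* ℝ}

theorem sum_pairConstraint_map (G : Market A S P) (e : G.Pair) (c d : K) (rel : LPRel) (r : K)
    (z : G.Var → ℝ) :
    ∑ v, ((G.pairConstraint e c d rel r).map φ).coeff v * z v =
      φ d * z none + φ c * z (some e) := by
  rw [Fintype.sum_option]
  congr 1
  rw [Finset.sum_eq_single e (fun e' _ h => by simp [LPConstraint.map, pairConstraint, h])
    (by simp)]
  simp [LPConstraint.map, pairConstraint]

variable [Fintype P]

theorem value_mainLP (G : Market A S P) (q : S → K) (t : G.Pair → K) (M : Finset (A × P))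
    (level : G.Pair → Option K) (z : G.Var → K) : (G.mainLP q t M level).value z = z none := by
  simp [LinearProgram.value, mainLP, Fintype.sum_option]

theorem value_auxLP (G : Market A S P) (q : S → K) (t : G.Pair → K) (M : Finset (A × P))
    (level : G.Pair → Option K) (lam : K) (e₀ : G.Pair) (z : G.Var → K) :
    (G.auxLP q t M level lam e₀).value z = z none := by
  simp [LinearProgram.value, auxLP, Fintype.sum_option]

theorem holds_fundingConstraints_iff (G : Market A S P) (q : S → K) (M : Finset (A × P))
    (z : G.Var → ℝ) :
    (∀ c ∈ G.fundingConstraints q M, (c.map φ).Holds z) ↔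
      G.IsFeasibleAllocation (fun s => φ (q s)) M (fun e => z (some e)) := by
  have h1 : ∀ e : G.Pair, ((G.pairConstraint e (1 : K) 0 .ge 0).map φ).Holds z ↔
      0 ≤ z (some e) := by
    intro e
    have := G.sum_pairConstraint_map (φ := φ) e 1 0 .ge 0 z
    change φ 0 ≤ _ ↔ _
    rw [this]
    simp
  have h2 : ∀ p : P, ((({ coeff := fun v => v.elim 0 fun e => if e.2.1 = p then 1 else 0
                          rel := .eq
                          rhs := (load M p : K) } : LPConstraint K G.Var)).map φ).Holds z ↔
      ∑ e : G.Pair with e.2.1 = p, z (some e) = (load M p : ℝ) := by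
    intro p
    simp only [LPConstraint.map, LPConstraint.Holds, Fintype.sum_option, map_natCast]
    simp [Finset.sum_filter, apply_ite φ]
  have h3 : ∀ s : S, ((({ coeff := fun v => v.elim 0 fun e => if e.1 = s then 1 else 0
                          rel := .le
                          rhs := q s } : LPConstraint K G.Var)).map φ).Holds z ↔
      ∑ p : {p : P // p ∈ G.projects s}, z (some ⟨s, p⟩) ≤ φ (q s) := by
    intro s
    simp only [LPConstraint.map, LPConstraint.Holds, Fintype.sum_option]
    simp only [Option.elim, map_zero, zero_mul, zero_add, apply_ite φ, map_one, ite_mul, one_mul]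
    rw [Fintype.sum_sigma, Finset.sum_eq_single s (fun s' _ h => by simp [h]) (by simp)]
    simp
  simp only [fundingConstraints, List.forall_mem_append, List.forall_mem_map, Finset.mem_toList,
    Finset.mem_univ, forall_true_left]
  rw [forall_congr' h1, forall_congr' h2, forall_congr' h3]
  exact ⟨fun h => ⟨h.1.1, h.1.2, h.2⟩, fun h => ⟨⟨h.1, h.2⟩, h.3⟩⟩

theorem holds_mainLP_iff (G : Market A S P) (q : S → K) (t : G.Pair → K) (M : Finset (A × P))
    (level : G.Pair → Option K) (z : G.Var → ℝ) :
    (∀ c ∈ (G.mainLP q t M level).constraints, (c.map φ).Holds z) ↔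
      (fun e => z (some e)) ∈ G.cappedSet φ q t M level (z none) := by
  have h : ∀ e : G.Pair, ((match level e with
        | none => G.pairConstraint e (1 / t e) (-1) .le 0
        | some l => G.pairConstraint e (1 / t e) 0 .eq l).map φ).Holds z ↔
      ((∀ l, level e = some l → z (some e) / φ (t e) = φ l) ∧
        (level e = none → z (some e) / φ (t e) ≤ z none)) := by
    intro e
    cases hl : level e with
    | none =>
      have := G.sum_pairConstraint_map (φ := φ) e (1 / t e) (-1) .le 0 z
      change _ ≤ φ 0 ↔ _
      simp only [this]
      simp [div_eq_inv_mul]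
    | some l =>
      have := G.sum_pairConstraint_map (φ := φ) e (1 / t e) 0 .eq l z
      change _ = φ l ↔ _
      simp only [this]
      simp [div_eq_inv_mul]
  simp only [mainLP, List.forall_mem_append, List.forall_mem_map, Finset.mem_toList,
    Finset.mem_univ, forall_true_left, holds_fundingConstraints_iff]
  refine (and_congr Iff.rfl (forall_congr' h)).trans ?_
  rw [forall_and]
  exact and_assoc.symm

theorem holds_auxLP_iff (G : Market A S P) (q : S → K) (t : G.Pair → K) (M : Finset (A × P))
    (level : G.Pair → Option K) (lam : K) (e₀ : G.Pair) (h₀ : level e₀ = none) (z : G.Var → ℝ) :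
    (∀ c ∈ (G.auxLP q t M level lam e₀).constraints, (c.map φ).Holds z) ↔
      (fun e => z (some e)) ∈ G.levelSet φ q t M level ∧
      (∀ e, e ≠ e₀ → level e = none → z (some e) / φ (t e) ≤ φ lam) ∧
      z (some e₀) / φ (t e₀) + z none ≤ φ lam := by
  have h : ∀ e : G.Pair, ((match level e with
        | none => G.pairConstraint e (1 / t e) (if e = e₀ then 1 else 0) .le lam
        | some l => G.pairConstraint e (1 / t e) 0 .eq l).map φ).Holds z ↔
      ((∀ l, level e = some l → z (some e) / φ (t e) = φ l) ∧
        (e ≠ e₀ → level e = none → z (some e) / φ (t e) ≤ φ lam) ∧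
        (e = e₀ → z (some e) / φ (t e) + z none ≤ φ lam)) := by
    intro e
    cases hl : level e with
    | none =>
      have := G.sum_pairConstraint_map (φ := φ) e (1 / t e) (if e = e₀ then 1 else 0) .le lam z
      change _ ≤ φ lam ↔ _
      simp only [this]
      by_cases he : e = e₀
      · simp [div_eq_inv_mul, he, add_comm]
      · simp [div_eq_inv_mul, he]
    | some l =>
      have hne : e ≠ e₀ := by rintro rfl; simp [h₀] at hl
      have := G.sum_pairConstraint_map (φ := φ) e (1 / t e) 0 .eq l z
      change _ = φ l ↔ _
      simp only [this]
      simp [div_eq_inv_mul, hne]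
  simp only [auxLP, List.forall_mem_append, List.forall_mem_map, Finset.mem_toList,
    Finset.mem_univ, forall_true_left, holds_fundingConstraints_iff]
  refine (and_congr Iff.rfl (forall_congr' h)).trans ?_
  rw [forall_and, forall_and, forall_eq]
  exact and_assoc.symm

variable [LinearOrder K] [IsStrictOrderedRing K]

/-- The optimal value of the main program is the least cap that the pairs that are not tight can
be kept under. -/
theorem isLeast_solve_mainLP (hφ : StrictMono φ) (G : Market A S P) (q : S → K) (t : G.Pair → K)
    (M : Finset (A × P)) (ht : ∀ e, 0 < t e) (level : G.Pair → Option K)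
    (alg : LPAlgorithm K G.Var) (hex : ∃ e, level e = none)
    (hne : (G.levelSet φ q t M level).Nonempty) :
    IsLeast {lam | (G.cappedSet φ q t M level lam).Nonempty}
      (φ (alg.solve (G.mainLP q t M level))) := by
  obtain ⟨e₀, he₀⟩ := hex
  have ht' : ∀ e, 0 < φ (t e) := fun e => by simpa using hφ (ht e)
  have := alg.isLeast_solve hφ (G.mainLP q t M level) none (G.value_mainLP q t M level) rfl ?_ 0 ?_
  · refine ⟨?_, ?_⟩
    · obtain ⟨z, hz, hv⟩ := this.1
      exact ⟨_, hv ▸ (G.holds_mainLP_iff q t M level z).1 hz⟩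
    · rintro lam ⟨x, hx⟩
      exact this.2 ⟨fun v => v.elim lam x, (G.holds_mainLP_iff q t M level _).2 hx, rfl⟩
  · obtain ⟨x, hx⟩ := hne
    refine ⟨fun v => v.elim (∑ e, x e / φ (t e)) x, (G.holds_mainLP_iff q t M level _).2
      ⟨hx, fun e _ => ?_⟩⟩
    exact Finset.single_le_sum (f := fun e => x e / φ (t e))
      (fun e _ => div_nonneg (hx.1.nonneg e) (ht' e).le) (Finset.mem_univ e)
  · intro z hz
    obtain ⟨hx, hcap⟩ := (G.holds_mainLP_iff q t M level z).1 hz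
    exact (div_nonneg (hx.1.nonneg e₀) (ht' e₀).le).trans (hcap e₀ he₀)

/-- The auxiliary program for `e₀` has optimal value zero iff `e₀` is at the cap in every
allocation under the cap. -/
theorem solve_auxLP_eq_zero_iff (hφ : StrictMono φ) (G : Market A S P) (q : S → K)
    (t : G.Pair → K) (M : Finset (A × P)) (ht : ∀ e, 0 < t e) (level : G.Pair → Option K)
    (alg : LPAlgorithm K G.Var) (lam : K) (e₀ : G.Pair) (h₀ : level e₀ = none)
    (hne : (G.cappedSet φ q t M level (φ lam)).Nonempty) :
    alg.solve (G.auxLP q t M level lam e₀) = 0 ↔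
      ∀ x ∈ G.cappedSet φ q t M level (φ lam), x e₀ / φ (t e₀) = φ lam := by
  have ht' : ∀ e, 0 < φ (t e) := fun e => by simpa using hφ (ht e)
  have hfeas : ∀ x ∈ G.cappedSet φ q t M level (φ lam), ∀ ε, x e₀ / φ (t e₀) + ε ≤ φ lam →
      ∀ c ∈ (G.auxLP q t M level lam e₀).constraints, (c.map φ).Holds fun v => v.elim ε x := by
    intro x hx ε hε
    exact (G.holds_auxLP_iff q t M level lam e₀ h₀ _).2
      ⟨hx.1, fun e _ he => hx.2 e he, hε⟩
  obtain ⟨x₀, hx₀⟩ := hne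
  have h0 := hfeas x₀ hx₀ 0 (by simpa using hx₀.2 e₀ h₀)
  obtain ⟨⟨z, hz, hzv⟩, hub⟩ := alg.isGreatest_solve hφ (G.auxLP q t M level lam e₀) none
    (G.value_auxLP q t M level lam e₀) rfl ⟨_, h0⟩ (φ lam) (by
      intro z hz
      obtain ⟨hx, -, h⟩ := (G.holds_auxLP_iff q t M level lam e₀ h₀ z).1 hz
      linarith [div_nonneg (hx.1.nonneg e₀) (ht' e₀).le])
  have hnonneg : 0 ≤ φ (alg.solve (G.auxLP q t M level lam e₀)) := hub ⟨_, h0, rfl⟩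
  constructor
  · intro hv x hx
    have := hub ⟨_, hfeas x hx (φ lam - x e₀ / φ (t e₀)) (by linarith), rfl⟩
    rw [hv, map_zero] at this
    simp only [Option.elim] at this
    exact le_antisymm (hx.2 e₀ h₀) (by linarith)
  · intro hall
    obtain ⟨hx, hcap, h⟩ := (G.holds_auxLP_iff q t M level lam e₀ h₀ z).1 hz
    have := hall _ ⟨hx, fun e he => ?_⟩
    · apply φ.injective
      rw [map_zero]
      linarith
    · by_cases hee : e = e₀
      · subst hee; linarith
      · exact hcap e hee he

end Programs

end Market

/-! ### Correctness and cost of a run -/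

namespace Market

variable {A S P K : Type*} [Fintype S] [DecidableEq P] [Field K]

section Caps

variable {φ : K →+* ℝ} {G : Market A S P} {q : S → K} {t : G.Pair → K} {M : Finset (A × P)}
  {level : G.Pair → Option K}

theorem midpoint_mem_cappedSet {lam : ℝ} {x y : G.Pair → ℝ}
    (hx : x ∈ G.cappedSet φ q t M level lam) (hy : y ∈ G.cappedSet φ q t M level lam) :
    (fun e => (x e + y e) / 2) ∈ G.cappedSet φ q t M level lam := by
  obtain ⟨⟨⟨x0, xp, xb⟩, xt⟩, xc⟩ := hx
  obtain ⟨⟨⟨y0, yp, yb⟩, yt⟩, yc⟩ := hy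
  refine ⟨⟨⟨fun e => by linarith [x0 e, y0 e], fun p => ?_, fun s => ?_⟩, fun e l h => ?_⟩,
    fun e h => ?_⟩
  · rw [← Finset.sum_div, Finset.sum_add_distrib, xp, yp]; ring
  · rw [← Finset.sum_div, Finset.sum_add_distrib]; linarith [xb s, yb s]
  · rw [div_right_comm, add_div, xt e l h, yt e l h]; ring
  · rw [div_right_comm, add_div]; linarith [xc e h, yc e h]

/-- At the least possible cap some pair that is not tight is at the cap in all allocations:
otherwise averaging would push all of them strictly below it. -/
theorem exists_forced_of_isLeast {lam : ℝ} (hex : ∃ e, level e = none)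
    (hlam : IsLeast {lam | (G.cappedSet φ q t M level lam).Nonempty} lam) :
    ∃ e, level e = none ∧ ∀ x ∈ G.cappedSet φ q t M level lam, x e / φ (t e) = lam := by
  classical
  by_contra! hno
  have key : ∀ E : Finset G.Pair, (∀ e ∈ E, level e = none) →
      ∃ x ∈ G.cappedSet φ q t M level lam, ∀ e ∈ E, x e / φ (t e) < lam := by
    intro E
    induction E using Finset.induction_on with
    | empty => exact fun _ => ⟨_, hlam.1.some_mem, by simp⟩
    | insert e E _ ih =>
      intro hE
      obtain ⟨x, hx, hxE⟩ := ih fun e' h => hE e' (Finset.mem_insert_of_mem h)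
      have he := hE e (Finset.mem_insert_self _ _)
      obtain ⟨y, hy, hye⟩ := hno e he
      refine ⟨_, midpoint_mem_cappedSet hx hy, fun e' he' => ?_⟩
      rw [div_right_comm, add_div]
      rcases Finset.mem_insert.1 he' with rfl | h
      · linarith [hx.2 e' he, lt_of_le_of_ne (hy.2 e' he) hye]
      · linarith [hy.2 e' (hE e' he'), hxE e' h]
  obtain ⟨x, hx, hlt⟩ := key (Finset.univ.filter fun e => level e = none) (by simp)
  obtain ⟨e₀, he₀⟩ := hex
  obtain ⟨e₁, he₁, hmax⟩ := Finset.exists_max_image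
    (Finset.univ.filter fun e => level e = none) (fun e => x e / φ (t e)) ⟨e₀, by simpa using he₀⟩
  have := hlam.2 (show (G.cappedSet φ q t M level (x e₁ / φ (t e₁))).Nonempty from
    ⟨x, hx.1, fun e he => hmax e (by simpa using he)⟩)
  exact (hlt e₁ he₁).not_ge this

theorem cappedSet_update [DecidableEq S] {lam : K} {e₀ : G.Pair} (h₀ : level e₀ = none)
    (hforced : ∀ x ∈ G.cappedSet φ q t M level (φ lam), x e₀ / φ (t e₀) = φ lam) :
    G.cappedSet φ q t M (Function.update level e₀ (some lam)) (φ lam) =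
      G.cappedSet φ q t M level (φ lam) := by
  ext x
  constructor
  · rintro ⟨⟨hf, ht⟩, hc⟩
    have he₀ := ht e₀ lam (by simp)
    refine ⟨⟨hf, fun e l h => ht e l ?_⟩, fun e h => ?_⟩
    · rwa [Function.update_of_ne]
      rintro rfl
      simp [h₀] at h
    · by_cases hee : e = e₀
      · exact hee ▸ he₀.le
      · exact hc e (by rwa [Function.update_of_ne hee])
  · intro hx
    refine ⟨⟨hx.1.1, fun e l h => ?_⟩, fun e h => ?_⟩
    · by_cases hee : e = e₀
      · subst hee
        rw [Function.update_self, Option.some_inj] at h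
        exact h ▸ hforced x hx
      · exact hx.1.2 e l (by rwa [Function.update_of_ne hee] at h)
    · by_cases hee : e = e₀
      · subst hee
        simp at h
      · exact hx.2 e (by rwa [Function.update_of_ne hee] at h)

/-- If `x` and `y` agree on the tight pairs, and `x` keeps the others under a cap that `y`
exceeds, then `x` is lexicographically better. -/
theorem lex_ratioVector_of_cap {lam : ℝ} {x y : G.Pair → ℝ}
    (hx : x ∈ G.cappedSet φ q t M level lam) (hy : y ∈ G.levelSet φ q t M level)
    (hy' : y ∉ G.cappedSet φ q t M level lam) :
    List.Lex (· < ·) (G.ratioVector (fun e => φ (t e)) x)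
      (G.ratioVector (fun e => φ (t e)) y) := by
  refine lex_sort_map_of_threshold _ _ {e | level e ≠ none} lam ?_ ?_ ?_
  · intro e he
    obtain ⟨l, hl⟩ := Option.ne_none_iff_exists'.1 he
    exact (hx.1.2 e l hl).trans (hy.2 e l hl).symm
  · intro e he
    exact hx.2 e (not_not.1 he)
  · by_contra! hno
    exact hy' ⟨hy, fun e he => hno e (not_not.2 he)⟩

end Caps

/-- The ratios `ratio` complete the table `level`: they extend what it records about tight pairs. -/
def Completes {G : Market A S P} (ratio : G.Pair → K) (level : G.Pair → Option K) : Prop :=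
  ∀ e l, level e = some l → ratio e = l

variable [Fintype P] [DecidableEq S] [LinearOrder K]

/-- The programs that a run with final ratios `ratio` solves: all levels and caps that occur in
them are among the final ratios. -/
inductive IsRunProgram (G : Market A S P) (q : S → K) (t : G.Pair → K) (M : Finset (A × P))
    (ratio : G.Pair → K) : LinearProgram K G.Var → Prop
  | main (level : G.Pair → Option K) (h : Completes ratio level) :
      IsRunProgram G q t M ratio (G.mainLP q t M level)
  | aux (level : G.Pair → Option K) (e e₀ : G.Pair) (h : Completes ratio level) :
      IsRunProgram G q t M ratio (G.auxLP q t M level (ratio e) e₀)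

/-- The time spent on one linear program. -/
def callCost {G : Market A S P} (cm : CostModel K G.Var) (alg : LPAlgorithm K G.Var)
    (lp : LinearProgram K G.Var) : ℕ :=
  cm.program lp + alg.time lp

section Run

variable {φ : K →+* ℝ} (G : Market A S P) (cm : CostModel K G.Var)
  (alg : LPAlgorithm K G.Var) (q : S → K) (t : G.Pair → K) (M : Finset (A × P))

theorem forBody_level_of_eq_zero (lam : K) (st : RunState G K) (e : G.Pair)
    (h : alg.solve (G.auxLP q t M st.level lam e) = 0) :
    (G.forBody cm alg q t M lam st e).level = Function.update st.level e (some lam) := by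
  simp [forBody, h, RunState.tick, RunState.call]

theorem forBody_level_of_ne_zero (lam : K) (st : RunState G K) (e : G.Pair)
    (h : alg.solve (G.auxLP q t M st.level lam e) ≠ 0) :
    (G.forBody cm alg q t M lam st e).level = st.level := by
  simp [forBody, h, RunState.tick, RunState.call]

theorem forBody_solved (lam : K) (st : RunState G K) (e : G.Pair) :
    (G.forBody cm alg q t M lam st e).solved = G.auxLP q t M st.level lam e :: st.solved := by
  unfold forBody
  dsimp only
  split_ifs <;> rfl

theorem forBody_time_le (lam : K) (st : RunState G K) (e : G.Pair) :
    (G.forBody cm alg q t M lam st e).time ≤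
      st.time + callCost cm alg (G.auxLP q t M st.level lam e) + (2 * cm.index + cm.num lam) := by
  unfold forBody callCost
  dsimp only
  split_ifs <;> simp only [RunState.tick, RunState.call] <;> omega

/-- The programs solved by the inner loop and its running time. -/
theorem foldl_forBody_run (lam : K) (l : List G.Pair) :
    ∀ st : RunState G K, l.Nodup → (∀ e ∈ l, st.level e = none) →
      ∀ ratio : G.Pair → K,
        Completes ratio (l.foldl (G.forBody cm alg q t M lam) st).level →
        Completes ratio st.level ∧ ∃ new,
          (l.foldl (G.forBody cm alg q t M lam) st).solved = new ++ st.solved ∧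
          new.length = l.length ∧
          (∀ lp ∈ new, ∃ level e, Completes ratio level ∧ lp = G.auxLP q t M level lam e) ∧
          (l.foldl (G.forBody cm alg q t M lam) st).time ≤
            st.time + (new.map (callCost cm alg)).sum +
              l.length * (2 * cm.index + cm.num lam) := by
  induction l with
  | nil =>
    intro st _ _ ratio h
    exact ⟨h, [], by simp⟩
  | cons e₀ l ih =>
    intro st hnd hl ratio hr
    obtain ⟨he₀l, hnd'⟩ := List.nodup_cons.1 hnd
    have h₀ : st.level e₀ = none := hl e₀ (by simp)
    have hext : ∀ e, e ≠ e₀ → (G.forBody cm alg q t M lam st e₀).level e = st.level e := by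
      intro e he
      by_cases hz : alg.solve (G.auxLP q t M st.level lam e₀) = 0
      · rw [G.forBody_level_of_eq_zero cm alg q t M lam st e₀ hz, Function.update_of_ne he]
      · rw [G.forBody_level_of_ne_zero cm alg q t M lam st e₀ hz]
    rw [List.foldl_cons] at hr ⊢
    obtain ⟨hc, new, hs, hlen, hprog, htime⟩ := ih (G.forBody cm alg q t M lam st e₀) hnd'
      (fun e he => by
        rw [hext e (by rintro rfl; exact he₀l he)]
        exact hl e (by simp [he])) ratio hr
    have hc' : Completes ratio st.level := by
      intro e l' h
      have hne : e ≠ e₀ := by rintro rfl; simp [h₀] at h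
      exact hc e l' (by rw [hext e hne, h])
    refine ⟨hc', new ++ [G.auxLP q t M st.level lam e₀], ?_, by simp [hlen], ?_, ?_⟩
    · rw [hs, forBody_solved]; simp
    · intro lp hlp
      rcases List.mem_append.1 hlp with h | h
      · exact hprog lp h
      · exact ⟨_, _, hc', List.mem_singleton.1 h⟩
    · have := G.forBody_time_le cm alg q t M lam st e₀
      simp only [List.map_append, List.sum_append, List.map_cons, List.map_nil, List.sum_cons,
        List.sum_nil, List.length_cons, add_mul, one_mul] at htime ⊢
      omega

theorem whileBody_run (st : RunState G K) (ratio : G.Pair → K)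
    (hr : Completes ratio (G.whileBody cm alg q t M st).level)
    (hmem : ∃ e, ratio e = alg.solve (G.mainLP q t M st.level)) :
    Completes ratio st.level ∧ ∃ new,
      (G.whileBody cm alg q t M st).solved = new ++ st.solved ∧
      new.length ≤ Fintype.card G.Pair + 1 ∧ (∀ lp ∈ new, G.IsRunProgram q t M ratio lp) ∧
      ∀ w, (∀ e, cm.num (ratio e) ≤ w) → (G.whileBody cm alg q t M st).time ≤
        st.time + (new.map (callCost cm alg)).sum + Fintype.card G.Pair * cm.index +
          Fintype.card G.Pair * (2 * cm.index + w) := by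
  obtain ⟨e₁, he₁⟩ := hmem
  obtain ⟨hc, new, hs, hlen, hprog, htime⟩ := G.foldl_forBody_run cm alg q t M _
    ((Finset.univ : Finset G.Pair).toList.filter fun e => (st.level e).isNone)
    ((st.call cm alg (G.mainLP q t M st.level)).tick (Fintype.card G.Pair * cm.index))
    ((Finset.nodup_toList _).filter _) (by
      intro e he
      simpa [RunState.call, RunState.tick] using he) ratio hr
  change Completes ratio st.level at hc
  have hlen' : ((Finset.univ : Finset G.Pair).toList.filter
      fun e => (st.level e).isNone).length ≤ Fintype.card G.Pair :=
    (List.length_filter_le _ _).trans (by simp)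
  refine ⟨hc, new ++ [G.mainLP q t M st.level], ?_, ?_, ?_, fun w hw => ?_⟩
  · rw [List.append_assoc]; exact hs
  · simpa [hlen] using hlen'
  · intro lp hlp
    rcases List.mem_append.1 hlp with h | h
    · obtain ⟨level, e, hl, rfl⟩ := hprog lp h
      rw [← he₁]
      exact .aux level e₁ e hl
    · rw [List.mem_singleton.1 h]
      exact .main _ hc
  · have h1 := Nat.mul_le_mul hlen' (Nat.add_le_add_left (he₁ ▸ hw e₁) (2 * cm.index))
    change (G.whileBody cm alg q t M st).time ≤ _ at htime
    simp only [RunState.call, RunState.tick] at htime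
    simp only [List.map_append, List.sum_append, List.map_cons, List.map_nil, List.sum_cons,
      List.sum_nil, callCost] at htime ⊢
    omega

theorem whileLoop_of_forall_isSome (n : ℕ) (st : RunState G K) (h : ∀ e, (st.level e).isSome) :
    G.whileLoop cm alg q t M n st =
      some (st.tick ((Fintype.card G.Pair + 1) * cm.index)) := by
  unfold whileLoop
  exact if_pos h

theorem whileLoop_succ (n : ℕ) (st : RunState G K) (h : ¬∀ e, (st.level e).isSome) :
    G.whileLoop cm alg q t M (n + 1) st = G.whileLoop cm alg q t M n
      (G.whileBody cm alg q t M (st.tick ((Fintype.card G.Pair + 1) * cm.index))) := by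
  rw [whileLoop]
  exact if_neg h

/-- What the outer loop achieves within `n` iterations from the state `st`, leaving `out` with final
ratios `ratio`: among the allocations that respect the initial table, the final one is
lexicographically best, and it obeys every cap that can be obeyed. -/
structure LoopSpec (φ : K →+* ℝ) (n : ℕ) (st out : RunState G K) (ratio : G.Pair → K) : Prop where
  eq_some : G.whileLoop cm alg q t M n st = some out
  level_eq : ∀ e, out.level e = some (ratio e)
  completes : Completes ratio st.level
  mem_cappedSet : ∀ μ, (G.cappedSet φ q t M st.level μ).Nonempty →
    (fun e => φ (ratio e * t e)) ∈ G.cappedSet φ q t M st.level μ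
  lex : ∀ y ∈ G.levelSet φ q t M st.level, y = (fun e => φ (ratio e * t e)) ∨
    List.Lex (· < ·) (G.ratioVector (fun e => φ (t e)) fun e => φ (ratio e * t e))
      (G.ratioVector (fun e => φ (t e)) y)
  run : ∃ new, out.solved = new ++ st.solved ∧ new.length ≤ n * (Fintype.card G.Pair + 1) ∧
    (∀ lp ∈ new, G.IsRunProgram q t M ratio lp) ∧
    ∀ w, (∀ e, cm.num (ratio e) ≤ w) → out.time ≤
      st.time + (new.map (callCost cm alg)).sum + (Fintype.card G.Pair + 1) * cm.index +
        n * ((2 * Fintype.card G.Pair + 1) * cm.index +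
          Fintype.card G.Pair * (2 * cm.index + w))

theorem exists_loopSpec_of_forall_isSome (ht : ∀ e, 0 < t e) (n : ℕ) (st : RunState G K)
    (hall : ∀ e, (st.level e).isSome) :
    ∃ out ratio, G.LoopSpec cm alg q t M φ n st out ratio := by
  choose ratio hratio using fun e => Option.isSome_iff_exists.1 (hall e)
  have hx : ∀ y ∈ G.levelSet φ q t M st.level, y = fun e => φ (ratio e * t e) := by
    intro y hy
    funext e
    rw [map_mul, ← hy.2 e _ (hratio e), div_mul_cancel₀ _ (by simpa using (ht e).ne')]
  refine ⟨_, ratio, G.whileLoop_of_forall_isSome cm alg q t M _ st hall, hratio,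
    fun e l h => by rw [hratio, Option.some_inj] at h; exact h, ?_,
    fun y hy => Or.inl (hx y hy), [], rfl, by simp, by simp, fun w _ => ?_⟩
  · rintro μ ⟨y, hy⟩
    exact hx y hy.1 ▸ hy
  · simp only [RunState.tick, List.map_nil, List.sum_nil]
    omega

variable [IsStrictOrderedRing K]

/-- The inner loop makes exactly those pairs tight that are at the cap in all allocations under
the cap; recording them does not change the set of these allocations. -/
theorem foldl_forBody_level (hφ : StrictMono φ) (ht : ∀ e, 0 < t e) (lam : K) (l : List G.Pair) :
    ∀ st : RunState G K, l.Nodup → (∀ e ∈ l, st.level e = none) →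
      (G.cappedSet φ q t M st.level (φ lam)).Nonempty →
      ∀ e,
        (e ∈ l ∧ (∀ x ∈ G.cappedSet φ q t M st.level (φ lam), x e / φ (t e) = φ lam) →
          (l.foldl (G.forBody cm alg q t M lam) st).level e = some lam) ∧
        (¬(e ∈ l ∧ ∀ x ∈ G.cappedSet φ q t M st.level (φ lam), x e / φ (t e) = φ lam) →
          (l.foldl (G.forBody cm alg q t M lam) st).level e = st.level e) := by
  induction l with
  | nil => intro st _ _ _ e; simp
  | cons e₀ l ih =>
    intro st hnd hl hne e
    obtain ⟨he₀l, hnd'⟩ := List.nodup_cons.1 hnd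
    have h₀ : st.level e₀ = none := hl e₀ (by simp)
    have hiff := solve_auxLP_eq_zero_iff hφ G q t M ht st.level alg lam e₀ h₀ hne
    rw [List.foldl_cons]
    by_cases hz : alg.solve (G.auxLP q t M st.level lam e₀) = 0
    · have hlev := G.forBody_level_of_eq_zero cm alg q t M lam st e₀ hz
      have hcap := cappedSet_update h₀ (hiff.1 hz)
      have := ih (G.forBody cm alg q t M lam st e₀) hnd' (fun e he => by
        rw [hlev, Function.update_of_ne (by rintro rfl; exact he₀l he)]
        exact hl e (by simp [he])) (by rw [hlev, hcap]; exact hne) e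
      rw [hlev, hcap] at this
      by_cases hee : e = e₀
      · subst hee
        refine ⟨fun _ => ?_, fun h => absurd ⟨by simp, hiff.1 hz⟩ h⟩
        rw [this.2 fun h => he₀l h.1, Function.update_self]
      · rw [Function.update_of_ne hee] at this
        simpa [List.mem_cons, hee] using this
    · have hlev := G.forBody_level_of_ne_zero cm alg q t M lam st e₀ hz
      have := ih (G.forBody cm alg q t M lam st e₀) hnd' (fun e he => by
        rw [hlev]; exact hl e (by simp [he])) (by rw [hlev]; exact hne) e
      rw [hlev] at this
      by_cases hee : e = e₀
      · subst hee
        exact ⟨fun h => absurd (hiff.2 h.2) hz, fun _ => this.2 fun h => he₀l h.1⟩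
      · simpa [List.mem_cons, hee] using this

/-- One iteration of the outer loop: with `lam` the least cap, all allocations under the cap
`lam` respect the new table, some pair has become tight with ratio `lam`, and none has been lost. -/
theorem whileBody_level (hφ : StrictMono φ) (ht : ∀ e, 0 < t e) (st : RunState G K)
    (hex : ∃ e, st.level e = none) (hne : (G.levelSet φ q t M st.level).Nonempty) :
    IsLeast {lam | (G.cappedSet φ q t M st.level lam).Nonempty}
        (φ (alg.solve (G.mainLP q t M st.level))) ∧
      (∀ e l, st.level e = some l → (G.whileBody cm alg q t M st).level e = some l) ∧
      (∀ e, st.level e = none → (G.whileBody cm alg q t M st).level e = none ∨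
        (G.whileBody cm alg q t M st).level e = some (alg.solve (G.mainLP q t M st.level))) ∧
      (∃ e, st.level e = none ∧
        (G.whileBody cm alg q t M st).level e = some (alg.solve (G.mainLP q t M st.level))) ∧
      (∀ x ∈ G.cappedSet φ q t M st.level (φ (alg.solve (G.mainLP q t M st.level))),
        x ∈ G.levelSet φ q t M (G.whileBody cm alg q t M st).level) := by
  have hleast := isLeast_solve_mainLP hφ G q t M ht st.level alg hex hne
  refine ⟨hleast, ?_⟩
  set lam := alg.solve (G.mainLP q t M st.level) with hlam
  have key := G.foldl_forBody_level cm alg q t M hφ ht lam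
    ((Finset.univ : Finset G.Pair).toList.filter fun e => (st.level e).isNone)
    ((st.call cm alg (G.mainLP q t M st.level)).tick (Fintype.card G.Pair * cm.index))
    ((Finset.nodup_toList _).filter _) (by
      intro e he
      simpa [RunState.call, RunState.tick] using he) hleast.1
  change ∀ e, (_ → (G.whileBody cm alg q t M st).level e = some lam) ∧
    (_ → (G.whileBody cm alg q t M st).level e = st.level e) at key
  simp only [List.mem_filter, Finset.mem_toList, Finset.mem_univ, true_and,
    Option.isNone_iff_eq_none] at key
  change ∀ e, (st.level e = none ∧ (∀ x ∈ G.cappedSet φ q t M st.level (φ lam), _) → _) ∧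
    (¬(st.level e = none ∧ ∀ x ∈ G.cappedSet φ q t M st.level (φ lam), _) → _) at key
  have hsome : ∀ e l, st.level e = some l → (G.whileBody cm alg q t M st).level e = some l := by
    intro e l h
    rw [(key e).2 (by simp [h]), h]
  refine ⟨hsome, fun e he => ?_, ?_, fun x hx => ⟨hx.1.1, fun e l hl => ?_⟩⟩
  · by_cases hf : ∀ x ∈ G.cappedSet φ q t M st.level (φ lam), x e / φ (t e) = φ lam
    · exact Or.inr ((key e).1 ⟨he, hf⟩)
    · exact Or.inl (((key e).2 fun h => hf h.2).trans he)
  · obtain ⟨e, he, hf⟩ := exists_forced_of_isLeast hex hleast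
    exact ⟨e, he, (key e).1 ⟨he, hf⟩⟩
  · by_cases hf : st.level e = none ∧
      ∀ x ∈ G.cappedSet φ q t M st.level (φ lam), x e / φ (t e) = φ lam
    · rw [(key e).1 hf, Option.some_inj] at hl
      exact hl ▸ hf.2 x hx
    · rw [(key e).2 hf] at hl
      exact hx.1.2 e l hl

/-- The outer loop meets its specification as soon as some feasible allocation respects the
initial table. Each iteration makes a pair tight, so that there are at most as many iterations as
pairs. -/
theorem exists_loopSpec (hφ : StrictMono φ) (ht : ∀ e, 0 < t e) (n : ℕ) :
    ∀ st : RunState G K, (G.levelSet φ q t M st.level).Nonempty →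
      (Finset.univ.filter fun e => st.level e = none).card ≤ n →
      ∃ out ratio, G.LoopSpec cm alg q t M φ n st out ratio := by
  induction n with
  | zero =>
    intro st _ hn
    refine G.exists_loopSpec_of_forall_isSome cm alg q t M ht 0 st fun e => ?_
    rw [Option.isSome_iff_ne_none]
    intro he
    exact not_lt.2 hn (Finset.card_pos.2 ⟨e, by simpa using he⟩)
  | succ n ih =>
    intro st hne hn
    by_cases hall : ∀ e, (st.level e).isSome
    · exact G.exists_loopSpec_of_forall_isSome cm alg q t M ht (n + 1) st hall
    have ht' : ∀ e, φ (t e) ≠ 0 := fun e => by simpa using (ht e).ne'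
    have hex : ∃ e, st.level e = none := by simpa using hall
    set st₁ := st.tick ((Fintype.card G.Pair + 1) * cm.index) with hst₁
    obtain ⟨hleast, hsome, hnone, ⟨e₁, he₁, he₁'⟩, hsub⟩ :=
      G.whileBody_level cm alg q t M hφ ht st₁ hex hne
    have hrun := G.whileBody_run cm alg q t M st₁
    set lam := alg.solve (G.mainLP q t M st₁.level)
    set st₂ := G.whileBody cm alg q t M st₁ with hst₂
    change st.level e₁ = none at he₁
    have hnone' : ∀ e, st₂.level e = none → st.level e = none := by
      intro e he
      by_contra hne
      obtain ⟨l, hl⟩ := Option.ne_none_iff_exists'.1 hne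
      rw [hsome e l hl] at he
      simp at he
    have hcard : (Finset.univ.filter fun e => st₂.level e = none).card <
        (Finset.univ.filter fun e => st.level e = none).card := by
      apply Finset.card_lt_card
      rw [Finset.ssubset_iff_of_subset]
      · exact ⟨e₁, by simpa using he₁, by simp [he₁']⟩
      · intro e he
        simpa using hnone' e (by simpa using he)
    obtain ⟨x₀, hx₀⟩ := hleast.1
    obtain ⟨out, ratio, hout, hlev, hcomp, hcap, hlex, new, hsol, hlen, hprog, htime⟩ :=
      ih st₂ ⟨x₀, hsub x₀ hx₀⟩ (by omega)
    obtain ⟨hc, new', hsol', hlen', hprog', htime'⟩ := hrun ratio hcomp ⟨e₁, hcomp e₁ _ he₁'⟩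
    -- the final allocation respects the cap `lam` of this iteration
    have hfin : (fun e => φ (ratio e * t e)) ∈ G.cappedSet φ q t M st.level (φ lam) := by
      obtain ⟨⟨hf, -⟩, hc₂⟩ :=
        hcap (φ lam) ⟨x₀, hsub x₀ hx₀, fun e he => hx₀.2 e (hnone' e he)⟩
      refine ⟨⟨hf, fun e l h => ?_⟩, fun e he => ?_⟩
      · change φ (ratio e * t e) / φ (t e) = φ l
        rw [map_mul, mul_div_cancel_right₀ _ (ht' e), hc e l h]
      · rcases hnone e he with h | h
        · exact hc₂ e h
        · change φ (ratio e * t e) / φ (t e) ≤ φ lam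
          rw [map_mul, mul_div_cancel_right₀ _ (ht' e), hcomp e _ h]
    refine ⟨out, ratio, (G.whileLoop_succ cm alg q t M n st hall).trans hout, hlev, hc,
      fun μ hμ => ⟨hfin.1, fun e he => (hfin.2 e he).trans (hleast.2 hμ)⟩, fun y hy => ?_,
      new ++ new', ?_, ?_, ?_, fun w hw => ?_⟩
    · by_cases hy' : y ∈ G.cappedSet φ q t M st.level (φ lam)
      · exact hlex y (hsub y hy')
      · exact Or.inr (lex_ratioVector_of_cap hfin hy hy')
    · rw [hsol, hsol', List.append_assoc]; rfl
    · rw [List.length_append, add_mul, one_mul]; omega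
    · intro lp hlp
      rcases List.mem_append.1 hlp with h | h
      · exact hprog lp h
      · exact hprog' lp h
    · have h1 := htime w hw
      have h2 := htime' w hw
      have h3 : st₁.time = st.time + (Fintype.card G.Pair + 1) * cm.index := rfl
      rw [h3] at h2
      rw [List.map_append, List.sum_append]
      linarith

/-- Termination, correctness and cost of the algorithm, for any field `K` of input data that
embeds into `ℝ` through `φ`, and any cost model. -/
theorem exists_terminatesWith (hφ : StrictMono φ) (ht : ∀ e, 0 < t e)
    (hf : G.IsFeasible (fun s => φ (q s)) M) :
    ∃ (out : RunResult G K) (ratio : G.Pair → K),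
      G.TerminatesWith cm alg q t M out ∧ out.allocation = (fun e => ratio e * t e) ∧
      G.IsFeasibleAllocation (fun s => φ (q s)) M (fun e => φ (out.allocation e)) ∧
      (∀ y, G.IsFeasibleAllocation (fun s => φ (q s)) M y →
        y = (fun e => φ (out.allocation e)) ∨
          List.Lex (· < ·) (G.ratioVector (fun e => φ (t e)) fun e => φ (out.allocation e))
            (G.ratioVector (fun e => φ (t e)) y)) ∧
      out.solved.length ≤ Fintype.card G.Pair * (Fintype.card G.Pair + 1) ∧
      (∀ lp ∈ out.solved, G.IsRunProgram q t M ratio lp) ∧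
      ∀ w v, (∀ e, cm.num (ratio e) ≤ w) → (∀ e, cm.num (t e) ≤ v) → out.time ≤
        (out.solved.map (callCost cm alg)).sum +
          (2 * Fintype.card G.Pair + 1) * cm.index +
          Fintype.card G.Pair * ((2 * Fintype.card G.Pair + 1) * cm.index +
            Fintype.card G.Pair * (2 * cm.index + w)) +
          Fintype.card G.Pair * (cm.index + w * v) := by
  obtain ⟨x, hx⟩ := hf
  have hx' : x ∈ G.levelSet φ q t M fun _ => none := ⟨hx, by simp⟩
  obtain ⟨out, ratio, hout, hlev, -, hcap, hlex, new, hsol, hlen, hprog, htime⟩ :=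
    G.exists_loopSpec cm alg q t M hφ ht (Fintype.card G.Pair)
      { level := fun _ => none, solved := [], time := Fintype.card G.Pair * cm.index }
      ⟨x, hx'⟩ (by simp)
  simp only [List.append_nil] at hsol
  refine ⟨_, ratio, ⟨Fintype.card G.Pair, by rw [egalitarianAlgorithm, hout]; rfl⟩, ?_, ?_, ?_,
    ?_, ?_, ?_⟩
  · simp [hlev]
  · obtain ⟨h, -⟩ := hcap (∑ e, |x e / φ (t e)|) ⟨x, hx', fun e _ =>
      (le_abs_self _).trans (Finset.single_le_sum (f := fun e => |x e / φ (t e)|)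
        (fun e _ => abs_nonneg _) (Finset.mem_univ e))⟩
    simpa [hlev] using h.1
  · intro y hy
    simpa [hlev] using hlex y ⟨hy, by simp⟩
  · simpa [hsol] using hlen
  · simpa [hsol] using hprog
  · intro w v hw hv
    have h1 := htime w hw
    have h2 : ∑ e : G.Pair, (cm.index + cm.num ((out.level e).getD 0) * cm.num (t e)) ≤
        Fintype.card G.Pair * (cm.index + w * v) := by
      refine (Finset.sum_le_card_nsmul _ _ (cm.index + w * v) fun e _ => ?_).trans (by simp)
      rw [hlev]
      exact Nat.add_le_add_left (Nat.mul_le_mul (hw e) (hv e)) _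
    simp only [hsol]
    rw [add_mul _ _ cm.index] at h1 ⊢
    simp only [add_mul, two_mul, one_mul] at h1 h2 ⊢
    omega

end Run

end Market

/-! ### Binary lengths -/

theorem two_le_ratBits (a : ℚ) : 2 ≤ ratBits a := by
  have : 0 < Nat.size a.den := Nat.size_pos.2 a.den_pos
  unfold ratBits
  omega

theorem ratBits_one_div (a : ℚ) (ha : 0 < a) : ratBits (1 / a) = ratBits a := by
  have hn : 0 < a.num := Rat.num_pos.2 ha
  unfold ratBits
  rw [one_div, Rat.num_inv, Rat.den_inv, Int.sign_eq_one_of_pos hn]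
  simp only [one_mul, Int.natAbs_natCast]
  rw [if_neg hn.ne']
  omega

theorem abs_le_two_pow_ratBits (a : ℚ) : |a| ≤ 2 ^ ratBits a := by
  have h1 : |a| ≤ (a.num.natAbs : ℚ) := by
    rw [← Rat.num_div_den a, abs_div, Rat.num_div_den, Nat.abs_cast, Nat.cast_natAbs, Int.cast_abs]
    exact div_le_self (abs_nonneg _) (by exact_mod_cast a.den_pos)
  have h2 : a.num.natAbs ≤ 2 ^ ratBits a :=
    (Nat.lt_size_self _).le.trans (Nat.pow_le_pow_right (by norm_num) (by unfold ratBits; omega))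
  exact h1.trans (by exact_mod_cast h2)

theorem den_le_two_pow_ratBits (a : ℚ) : a.den ≤ 2 ^ ratBits a :=
  (Nat.lt_size_self _).le.trans (Nat.pow_le_pow_right (by norm_num) (by unfold ratBits; omega))

theorem ratBits_le_of_eq_div {a : ℚ} {m d : ℤ} {k : ℕ} (hd : d ≠ 0) (ha : a = m / d)
    (hm : |m| ≤ 2 ^ k) (hdk : |d| ≤ 2 ^ k) : ratBits a ≤ 2 * k + 3 := by
  have hsize : ∀ n : ℕ, n ≤ 2 ^ k → n.size ≤ k + 1 := fun n hn =>
    Nat.size_le.2 (hn.trans_lt (Nat.pow_lt_pow_right (by norm_num) (by omega)))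
  have hm' : m.natAbs ≤ 2 ^ k := by
    rw [← Int.natCast_natAbs] at hm
    exact_mod_cast hm
  have hd' : d.natAbs ≤ 2 ^ k := by
    rw [← Int.natCast_natAbs] at hdk
    exact_mod_cast hdk
  have hnum : a.num.natAbs ≤ 2 ^ k := by
    rcases eq_or_ne m 0 with rfl | hm0
    · simp [ha]
    · refine (Int.natAbs_le_of_dvd_ne_zero ?_ hm0).trans hm'
      rw [ha, ← Rat.divInt_eq_div]
      exact Rat.num_dvd _ hd
  have hden : a.den ≤ 2 ^ k := by
    refine le_trans ?_ hd'
    have : (a.den : ℤ) ∣ d := by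
      rw [ha, ← Rat.divInt_eq_div]
      exact Rat.den_dvd _ _
    simpa using Int.natAbs_le_of_dvd_ne_zero this hd
  have h1 := hsize _ hnum
  have h2 := hsize _ hden
  unfold ratBits
  omega

/-- The unique solution `r` of a rectangular integral system `A r = b` with small entries has
small binary length: it solves the normal equations `AᵀA r = Aᵀb`, whose matrix is invertible, and
Cramer's rule applies to them. -/
theorem ratBits_le_of_unique_solution {R T : Type*} [Fintype R] [Fintype T] [DecidableEq T]
    (A : Matrix R T ℤ) (b : R → ℤ) (r : T → ℚ)
    (hr : ∀ i, ∑ j, (A i j : ℚ) * r j = b i)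
    (hinj : ∀ v : T → ℤ, A.mulVec v = 0 → v = 0) {h c n : ℕ}
    (hA : ∀ i j, |A i j| ≤ 2 ^ h) (hb : ∀ i, |b i| ≤ 2 ^ h)
    (hR : Fintype.card R ≤ 2 ^ c) (hT : Fintype.card T ≤ n) (e : T) :
    ratBits (r e) ≤ 2 * (n * n + (c + 2 * h) * n) + 3 := by
  set N : Matrix T T ℤ := A.transpose * A with hN
  set u : T → ℤ := A.transpose.mulVec b with hu
  have hdet : N.det ≠ 0 := by
    intro h0
    obtain ⟨v, hv, hNv⟩ := Matrix.exists_mulVec_eq_zero_iff.2 h0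
    refine hv (hinj v ?_)
    rw [← dotProduct_self_eq_zero, Matrix.dotProduct_mulVec, Matrix.vecMul_mulVec, ← hN,
      ← Matrix.dotProduct_mulVec, hNv, dotProduct_zero]
  have hprod : ∀ (f g : R → ℤ), (∀ i, |f i| ≤ 2 ^ h) → (∀ i, |g i| ≤ 2 ^ h) →
      |∑ i, f i * g i| ≤ 2 ^ (c + 2 * h) := by
    intro f g hf hg
    calc |∑ i, f i * g i| ≤ ∑ i, |f i * g i| := Finset.abs_sum_le_sum_abs _ _
      _ ≤ ∑ _i : R, (2 ^ h * 2 ^ h : ℤ) := by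
        refine Finset.sum_le_sum fun i _ => ?_
        rw [abs_mul]
        exact mul_le_mul (hf i) (hg i) (abs_nonneg _) (by positivity)
      _ = (Fintype.card R : ℤ) * (2 ^ h * 2 ^ h) := by simp
      _ ≤ 2 ^ c * (2 ^ h * 2 ^ h) := by
        gcongr
        exact_mod_cast hR
      _ = 2 ^ (c + 2 * h) := by ring
  have hNe : ∀ i j, |N i j| ≤ 2 ^ (c + 2 * h) := fun i j =>
    hprod _ _ (fun k => hA k i) fun k => hA k j
  have hue : ∀ i, |u i| ≤ 2 ^ (c + 2 * h) := fun i => hprod _ _ (fun k => hA k i) hb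
  have hbound : ∀ X : Matrix T T ℤ, (∀ i j, |X i j| ≤ 2 ^ (c + 2 * h)) →
      |X.det| ≤ 2 ^ (n * n + (c + 2 * h) * n) := by
    intro X hX
    have h1 := Matrix.det_le (abv := AbsoluteValue.abs) hX
    rw [nsmul_eq_mul] at h1
    refine h1.trans ?_
    have h2 : (Fintype.card T).factorial ≤ 2 ^ (n * n) := by
      calc (Fintype.card T).factorial ≤ n.factorial := Nat.factorial_le hT
        _ ≤ n ^ n := Nat.factorial_le_pow n
        _ ≤ (2 ^ n) ^ n := Nat.pow_le_pow_left n.lt_two_pow_self.le _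
        _ = 2 ^ (n * n) := (pow_mul _ _ _).symm
    have h2' : ((Fintype.card T).factorial : ℤ) ≤ 2 ^ (n * n) := by exact_mod_cast h2
    have h3 : ((2 : ℤ) ^ (c + 2 * h)) ^ Fintype.card T ≤ 2 ^ ((c + 2 * h) * n) := by
      rw [← pow_mul]
      exact pow_le_pow_right₀ (by norm_num) (Nat.mul_le_mul_left _ hT)
    rw [pow_add 2 (n * n)]
    exact mul_le_mul h2' h3 (by positivity) (by positivity)
  have hsol : (N.map (Int.cast : ℤ → ℚ)).mulVec r = fun i => (u i : ℚ) := by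
    funext i
    simp only [Matrix.mulVec, dotProduct, Matrix.map_apply, hN, hu, Matrix.mul_apply,
      Matrix.transpose_apply, Int.cast_sum, Int.cast_mul, ← hr, Finset.sum_mul, Finset.mul_sum]
    rw [Finset.sum_comm]
    exact Finset.sum_congr rfl fun k _ => Finset.sum_congr rfl fun j _ => mul_assoc _ _ _
  have hcramer : (N.det : ℚ) * r e = ((N.updateCol e u).det : ℚ) := by
    have h1 : (N.map (Int.cast : ℤ → ℚ)).det • r =
        (N.map (Int.cast : ℤ → ℚ)).cramer fun i => (u i : ℚ) := by
      rw [Matrix.cramer_eq_adjugate_mulVec, ← hsol, Matrix.mulVec_mulVec, Matrix.adjugate_mul,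
        Matrix.smul_mulVec, Matrix.one_mulVec]
    have h2 := congrFun h1 e
    have h3 : ∀ X : Matrix T T ℤ, (X.map (Int.cast : ℤ → ℚ)).det = (X.det : ℚ) := fun X =>
      ((Int.castRingHom ℚ).map_det X).symm
    rw [Matrix.cramer_apply, Pi.smul_apply, smul_eq_mul, h3] at h2
    rw [h2, ← h3, Matrix.map_updateCol]
    rfl
  have hdetq : (N.det : ℚ) ≠ 0 := by exact_mod_cast hdet
  refine ratBits_le_of_eq_div hdet (m := (N.updateCol e u).det) ?_ (hbound _ fun i j => ?_)
    (hbound _ hNe)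
  · rw [eq_div_iff hdetq, mul_comm, hcramer]
  · by_cases hj : j = e
    · subst hj; simpa using hue i
    · simpa [hj] using hNe i j

/-! ### The final ratios as the solution of a linear system in the input -/

namespace Market

variable {A S P : Type*} [Fintype S] [DecidableEq P]

/-- A direction of change of the ratios that keeps vanishing ratios, project loads and exhausted
budgets, and moves equal ratios equally, is zero at the egalitarian allocation: a small step along
it would lower the largest ratios that it affects and leave the larger ones alone. -/
theorem direction_eq_zero {G : Market A S P} {q : S → ℝ} {t : G.Pair → ℝ} {M : Finset (A × P)}
    {x : G.Pair → ℝ} (ht : ∀ e, 0 < t e) (hx : G.IsFeasibleAllocation q M x)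
    (hopt : ∀ y, G.IsFeasibleAllocation q M y →
      y = x ∨ List.Lex (· < ·) (G.ratioVector t x) (G.ratioVector t y))
    (d : G.Pair → ℝ) (h0 : ∀ e, x e / t e = 0 → d e = 0)
    (hp : ∀ p, ∑ e : G.Pair with e.2.1 = p, t e * d e = 0)
    (hs : ∀ s, ∑ p : {p : P // p ∈ G.projects s}, x ⟨s, p⟩ = q s →
      ∑ p : {p : P // p ∈ G.projects s}, t ⟨s, p⟩ * d ⟨s, p⟩ = 0)
    (heq : ∀ e e', x e / t e = x e' / t e' → d e = d e') : d = 0 := by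
  classical
  by_contra hd
  obtain ⟨e₁, he₁⟩ : ∃ e, d e ≠ 0 := Function.ne_iff.1 hd
  obtain ⟨e₀, he₀, hmax⟩ := Finset.exists_max_image (Finset.univ.filter fun e => d e ≠ 0)
    (fun e => x e / t e) ⟨e₁, by simpa using he₁⟩
  replace he₀ : d e₀ ≠ 0 := by simpa using he₀
  replace hmax : ∀ e, d e ≠ 0 → x e / t e ≤ x e₀ / t e₀ := fun e he => hmax e (by simpa using he)
  -- a sign under which the direction lowers the ratio of `e₀`
  obtain ⟨σ, hσ⟩ : ∃ σ : ℝ, σ * d e₀ < 0 := by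
    rcases lt_or_gt_of_ne he₀ with h | h
    · exact ⟨1, by linarith⟩
    · exact ⟨-1, by linarith⟩
  have hcont : ∀ a b c : ℝ, a < c → ∀ᶠ ε : ℝ in nhdsWithin 0 (Set.Ioi 0), a + ε * b < c := by
    intro a b c hac
    have : Filter.Tendsto (fun ε : ℝ => a + ε * b) (nhdsWithin 0 (Set.Ioi 0)) (nhds (a + 0 * b)) :=
      (Continuous.tendsto (by fun_prop) 0).mono_left nhdsWithin_le_nhds
    exact this.eventually (gt_mem_nhds (by simpa using hac))
  have ev1 : ∀ᶠ ε : ℝ in nhdsWithin 0 (Set.Ioi 0), ∀ e, 0 ≤ x e + ε * (σ * (t e * d e)) := by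
    refine Filter.eventually_all.2 fun e => ?_
    rcases (hx.nonneg e).eq_or_lt with h | h
    · refine Filter.Eventually.of_forall fun ε => ?_
      rw [← h, h0 e (by rw [← h, zero_div])]
      simp
    · filter_upwards [hcont (-x e) (-(σ * (t e * d e))) 0 (by linarith)] with ε hε
      linarith
  have ev2 : ∀ᶠ ε : ℝ in nhdsWithin 0 (Set.Ioi 0), ∀ s,
      ∑ p : {p : P // p ∈ G.projects s}, x ⟨s, p⟩ +
        ε * (σ * ∑ p : {p : P // p ∈ G.projects s}, t ⟨s, p⟩ * d ⟨s, p⟩) ≤ q s := by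
    refine Filter.eventually_all.2 fun s => ?_
    rcases (hx.budget_le s).eq_or_lt with h | h
    · refine Filter.Eventually.of_forall fun ε => ?_
      rw [hs s h, h]
      simp
    · filter_upwards [hcont _ (σ * ∑ p : {p : P // p ∈ G.projects s}, t ⟨s, p⟩ * d ⟨s, p⟩) _ h]
        with ε hε
      exact hε.le
  have ev3 : ∀ᶠ ε : ℝ in nhdsWithin 0 (Set.Ioi 0), ∀ e, x e / t e < x e₀ / t e₀ →
      x e / t e + ε * (σ * d e) < x e₀ / t e₀ := by
    refine Filter.eventually_all.2 fun e => ?_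
    by_cases h : x e / t e < x e₀ / t e₀
    · filter_upwards [hcont _ (σ * d e) _ h] with ε hε _
      exact hε
    · exact Filter.Eventually.of_forall fun ε h' => absurd h' h
  obtain ⟨ε, hε1, hε2, hε3, hε⟩ :=
    (ev1.and (ev2.and (ev3.and self_mem_nhdsWithin))).exists
  replace hε : 0 < ε := hε
  set y : G.Pair → ℝ := fun e => x e + ε * (σ * (t e * d e)) with hy
  have hyratio : ∀ e, y e / t e = x e / t e + ε * (σ * d e) := by
    intro e
    have := (ht e).ne'
    simp only [hy]
    field_simp
  have hyf : G.IsFeasibleAllocation q M y := by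
    refine ⟨hε1, fun p => ?_, fun s => ?_⟩
    · simp only [hy]
      rw [Finset.sum_add_distrib, ← Finset.mul_sum, ← Finset.mul_sum, hp, hx.project_eq]
      simp
    · simp only [hy]
      rw [Finset.sum_add_distrib, ← Finset.mul_sum, ← Finset.mul_sum]
      exact hε2 s
  have hlt : ∀ e, x e / t e ≤ x e₀ / t e₀ → y e / t e < x e₀ / t e₀ := by
    intro e he
    rw [hyratio]
    rcases he.eq_or_lt with h | h
    · rw [heq e e₀ h, h]
      linarith [mul_neg_of_pos_of_neg hε hσ]
    · exact hε3 e h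
  obtain ⟨e₂, he₂, hmax₂⟩ := Finset.exists_max_image
    (Finset.univ.filter fun e => x e / t e ≤ x e₀ / t e₀) (fun e => y e / t e)
    ⟨e₀, by simp⟩
  have hlex : List.Lex (· < ·) (G.ratioVector t y) (G.ratioVector t x) := by
    refine lex_sort_map_of_threshold _ _ {e | x e₀ / t e₀ < x e / t e} (y e₂ / t e₂) ?_ ?_ ?_
    · intro e he
      have : d e = 0 := by
        by_contra h
        exact (hmax e h).not_gt he
      rw [hyratio, this]
      ring
    · intro e he
      exact hmax₂ e (by simpa using he)
    · exact ⟨e₀, by simp, hlt e₂ (by simpa using he₂)⟩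
  rcases hopt y hyf with h | h
  · rw [h] at hlex
    exact irrefl (r := List.Lex (· < ·)) _ hlex
  · exact asymm (r := List.Lex (· < ·)) h hlex

end Market

namespace Market

section Input

variable {A S P : Type*} [Fintype S] [Fintype P] [DecidableEq P]

theorem ratBits_budget_le_inputBits (G : Market A S P) (q : S → ℚ) (t : G.Pair → ℚ)
    (M : Finset (A × P)) (s : S) : ratBits (q s) ≤ G.inputBits q t M := by
  have := Finset.single_le_sum (f := fun s => ratBits (q s)) (fun _ _ => Nat.zero_le _)
    (Finset.mem_univ s)
  unfold inputBits
  omega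

theorem ratBits_load_le_inputBits (G : Market A S P) (q : S → ℚ) (t : G.Pair → ℚ)
    (M : Finset (A × P)) (p : P) : ratBits (load M p) ≤ G.inputBits q t M := by
  have := Finset.single_le_sum (f := fun p => ratBits (load M p)) (fun _ _ => Nat.zero_le _)
    (Finset.mem_univ p)
  unfold inputBits
  omega

theorem ratBits_target_le_inputBits (G : Market A S P) (q : S → ℚ) (t : G.Pair → ℚ)
    (M : Finset (A × P)) (e : G.Pair) : ratBits (t e) ≤ G.inputBits q t M := by
  have := Finset.single_le_sum (f := fun e => ratBits (t e)) (fun _ _ => Nat.zero_le _)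
    (Finset.mem_univ e)
  unfold inputBits
  omega

theorem card_add_card_le_inputBits (G : Market A S P) (q : S → ℚ) (t : G.Pair → ℚ)
    (M : Finset (A × P)) :
    2 * (Fintype.card S + Fintype.card P + Fintype.card G.Pair) ≤ G.inputBits q t M := by
  have h1 := Finset.card_nsmul_le_sum Finset.univ (fun s => ratBits (q s)) 2
    fun s _ => two_le_ratBits _
  have h2 := Finset.card_nsmul_le_sum Finset.univ (fun p => ratBits (load M p)) 2
    fun p _ => two_le_ratBits _
  have h3 := Finset.card_nsmul_le_sum Finset.univ (fun e => ratBits (t e)) 2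
    fun e _ => two_le_ratBits _
  simp only [Finset.card_univ, smul_eq_mul] at h1 h2 h3
  unfold inputBits
  omega

/-- The budgets and targets have a common denominator that is at most `2` to the power of the
input length, namely the product of their denominators. -/
theorem exists_common_denominator (G : Market A S P) (q : S → ℚ) (t : G.Pair → ℚ)
    (M : Finset (A × P)) : ∃ D : ℕ, 0 < D ∧ D ≤ 2 ^ G.inputBits q t M ∧
      (∀ e, ∃ k : ℤ, (k : ℚ) = D * t e) ∧ ∀ s, ∃ k : ℤ, (k : ℚ) = D * q s := by
  have hint : ∀ (D : ℕ) (a : ℚ), a.den ∣ D → ∃ k : ℤ, (k : ℚ) = D * a := by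
    rintro _ a ⟨m, rfl⟩
    refine ⟨m * a.num, ?_⟩
    push_cast
    rw [mul_comm (a.den : ℚ), mul_assoc, Rat.den_mul_eq_num]
  refine ⟨(∏ e, (t e).den) * ∏ s, (q s).den, ?_, ?_, fun e => hint _ _ ?_, fun s => hint _ _ ?_⟩
  · exact Nat.mul_pos (Finset.prod_pos fun e _ => (t e).den_pos)
      (Finset.prod_pos fun s _ => (q s).den_pos)
  · have h1 : ∏ e, (t e).den ≤ 2 ^ ∑ e, ratBits (t e) := by
      rw [← Finset.prod_pow_eq_pow_sum]
      exact Finset.prod_le_prod' fun e _ => den_le_two_pow_ratBits _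
    have h2 : ∏ s, (q s).den ≤ 2 ^ ∑ s, ratBits (q s) := by
      rw [← Finset.prod_pow_eq_pow_sum]
      exact Finset.prod_le_prod' fun s _ => den_le_two_pow_ratBits _
    refine (Nat.mul_le_mul h1 h2).trans ?_
    rw [← pow_add]
    refine Nat.pow_le_pow_right (by norm_num) ?_
    unfold inputBits
    omega
  · exact (Finset.dvd_prod_of_mem (fun e => (t e).den) (Finset.mem_univ e)).mul_right _
  · exact (Finset.dvd_prod_of_mem (fun s => (q s).den) (Finset.mem_univ s)).mul_left _

/-- The ratios of the egalitarian allocation have polynomial binary length in the input alone: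
they are the only solution of the linear system that records which of them vanish, which are equal,
which budgets are exhausted, and all project loads. Hence the levels that the algorithm feeds
back into later programs do not grow from one iteration to the next. -/
theorem ratBits_ratio_le (G : Market A S P) (q : S → ℚ) (t : G.Pair → ℚ) (M : Finset (A × P))
    (ht : ∀ e, 0 < t e) (r : G.Pair → ℚ)
    (hx : G.IsFeasibleAllocation (fun s => (q s : ℝ)) M fun e => ((r e * t e : ℚ) : ℝ))
    (hopt : ∀ y, G.IsFeasibleAllocation (fun s => (q s : ℝ)) M y →
      y = (fun e => ((r e * t e : ℚ) : ℝ)) ∨ List.Lex (· < ·)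
        (G.ratioVector (fun e => (t e : ℝ)) fun e => ((r e * t e : ℚ) : ℝ))
        (G.ratioVector (fun e => (t e : ℝ)) y)) (e : G.Pair) :
    ratBits (r e) ≤ 14 * G.inputBits q t M ^ 2 + 3 := by
  classical
  obtain ⟨D, hD, hDle, hT, hQ⟩ := G.exists_common_denominator q t M
  choose T hT using hT
  choose Q hQ using hQ
  set B := G.inputBits q t M with hB
  have hcard := G.card_add_card_le_inputBits q t M
  rw [← hB] at hcard
  let tight : S → Prop := fun s => ∑ p : {p : P // p ∈ G.projects s}, r ⟨s, p⟩ * t ⟨s, p⟩ = q s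
  let N : Matrix (G.Pair ⊕ P ⊕ S ⊕ G.Pair × G.Pair) G.Pair ℤ := Matrix.of <|
    Sum.elim (fun e e' => if r e = 0 ∧ e' = e then 1 else 0) <|
    Sum.elim (fun p e' => if e'.2.1 = p then T e' else 0) <|
    Sum.elim (fun s e' => if tight s ∧ e'.1 = s then T e' else 0) fun ee e' =>
      if r ee.1 = r ee.2 then (if e' = ee.1 then 1 else 0) - (if e' = ee.2 then 1 else 0) else 0
  let b : G.Pair ⊕ P ⊕ S ⊕ G.Pair × G.Pair → ℤ :=
    Sum.elim 0 <| Sum.elim (fun p => D * load M p) <|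
    Sum.elim (fun s => if tight s then Q s else 0) 0
  have hsmall : ∀ (a : ℚ) (k : ℤ), (k : ℚ) = D * a → ratBits a ≤ B → |k| ≤ 2 ^ (2 * B) := by
    intro a k hk ha
    have h1 : |(k : ℚ)| ≤ 2 ^ B * 2 ^ B := by
      rw [hk, abs_mul, Nat.abs_cast]
      refine mul_le_mul (by exact_mod_cast hDle) ((abs_le_two_pow_ratBits a).trans ?_)
        (abs_nonneg _) (by positivity)
      exact pow_le_pow_right₀ (by norm_num) ha
    rw [← pow_add, ← two_mul] at h1
    exact_mod_cast h1
  have hTs : ∀ e, |T e| ≤ 2 ^ (2 * B) := fun e =>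
    hsmall _ _ (hT e) (G.ratBits_target_le_inputBits q t M e)
  have hQs : ∀ s, |Q s| ≤ 2 ^ (2 * B) := fun s =>
    hsmall _ _ (hQ s) (G.ratBits_budget_le_inputBits q t M s)
  have h1s : (1 : ℤ) ≤ 2 ^ (2 * B) := one_le_pow₀ (by norm_num)
  have h0s : (0 : ℤ) ≤ 2 ^ (2 * B) := by positivity
  have hload : ∀ p, ∑ e : G.Pair with e.2.1 = p, r e * t e = (load M p : ℚ) := fun p => by
    have := hx.project_eq p
    exact_mod_cast this
  have key := ratBits_le_of_unique_solution N b r ?_ ?_ (h := 2 * B) (c := 2 * B) (n := B)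
    ?_ ?_ ?_ (by omega) e
  · refine key.trans (le_of_eq ?_)
    ring
  · rintro (e | p | s | ⟨e, e'⟩)
    · by_cases h : r e = 0 <;> simp [N, b, h]
    · simp only [N, b, Matrix.of_apply, Sum.elim_inr, Sum.elim_inl, Int.cast_mul,
        Int.cast_natCast, ← hload p, Finset.mul_sum, Finset.sum_filter]
      refine Finset.sum_congr rfl fun e _ => ?_
      split_ifs
      · rw [hT]; ring
      · simp
    · simp only [N, b, Matrix.of_apply, Sum.elim_inr, Sum.elim_inl]
      by_cases h : tight s
      · simp only [h, true_and, if_true, hQ]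
        rw [Fintype.sum_sigma, Finset.sum_eq_single s (fun s' _ h => by simp [h]) (by simp),
          ← show _ = q s from h, Finset.mul_sum]
        refine Finset.sum_congr rfl fun p _ => ?_
        rw [if_pos rfl, hT]
        ring
      · simp [h]
    · by_cases h : r e = r e'
      · simp [N, b, h, sub_mul, Finset.sum_sub_distrib]
      · simp [N, b, h]
  · intro v hv
    have ht' : ∀ e, (0 : ℝ) < t e := fun e => by exact_mod_cast ht e
    have hDr : (D : ℝ) ≠ 0 := by exact_mod_cast hD.ne'
    have hTr : ∀ e, (T e : ℝ) = D * t e := fun e => by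
      exact_mod_cast congrArg (Rat.cast : ℚ → ℝ) (hT e)
    have hratio : ∀ e, ((r e * t e : ℚ) : ℝ) / (t e : ℝ) = r e := fun e => by
      push_cast
      exact mul_div_cancel_right₀ _ (ht' e).ne'
    have hzero := direction_eq_zero ht' hx hopt (fun e => (v e : ℝ)) ?_ ?_ ?_ ?_
    · funext e
      have := congrFun hzero e
      simpa using this
    · intro e he
      rw [hratio] at he
      have he' : r e = 0 := by exact_mod_cast he
      have := congrFun hv (Sum.inl e)
      simpa [N, Matrix.mulVec, dotProduct, he'] using this
    · intro p
      have := congrArg (Int.cast : ℤ → ℝ) (congrFun hv (Sum.inr (Sum.inl p)))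
      simp only [N, Matrix.mulVec, dotProduct, Matrix.of_apply, Sum.elim_inr, Sum.elim_inl,
        Pi.zero_apply, ite_mul, zero_mul, ← Finset.sum_filter, Int.cast_sum, Int.cast_mul, hTr,
        Int.cast_zero, mul_assoc, ← Finset.mul_sum] at this
      exact (mul_eq_zero.1 this).resolve_left hDr
    · intro s hs
      have hs' : tight s := by
        simp only [tight]
        exact_mod_cast hs
      have := congrArg (Int.cast : ℤ → ℝ) (congrFun hv (Sum.inr (Sum.inr (Sum.inl s))))
      simp only [N, Matrix.mulVec, dotProduct, Matrix.of_apply, Sum.elim_inr, Sum.elim_inl,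
        Pi.zero_apply, ite_mul, zero_mul, hs', true_and] at this
      rw [Fintype.sum_sigma, Finset.sum_eq_single s (fun s' _ h => by simp [h]) (by simp)] at this
      simp only [if_true, Int.cast_sum, Int.cast_mul, hTr, Int.cast_zero, mul_assoc,
        ← Finset.mul_sum] at this
      exact (mul_eq_zero.1 this).resolve_left hDr
    · intro e e' he
      rw [hratio, hratio] at he
      have he' : r e = r e' := by exact_mod_cast he
      have := congrFun hv (Sum.inr (Sum.inr (Sum.inr (e, e'))))
      simp [N, Matrix.mulVec, dotProduct, he', sub_mul, Finset.sum_sub_distrib, sub_eq_zero]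
        at this
      exact_mod_cast this
  · rintro (e | p | s | ⟨e, e'⟩) e'' <;> simp only [N, Matrix.of_apply, Sum.elim_inr, Sum.elim_inl]
    · split_ifs <;> simp [h1s]
    · split_ifs
      · exact hTs _
      · simp
    · split_ifs
      · exact hTs _
      · simp
    · split_ifs <;> simp [h1s]
  · rintro (e | p | s | ⟨e, e'⟩) <;> simp only [b, Sum.elim_inr, Sum.elim_inl]
    · simp
    · refine hsmall (load M p) _ (by push_cast; rfl) (G.ratBits_load_le_inputBits q t M p)
    · split_ifs
      · exact hQs _
      · simp
    · simp
  · simp only [Fintype.card_sum, Fintype.card_prod]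
    have h1 : Fintype.card G.Pair * Fintype.card G.Pair ≤ B * B :=
      Nat.mul_le_mul (by omega) (by omega)
    have h2 : B + 1 ≤ 2 ^ B := Nat.lt_two_pow_self
    calc _ ≤ B * (B + 1) := by rw [mul_add, mul_one]; omega
      _ ≤ 2 ^ B * 2 ^ B := Nat.mul_le_mul (by omega) h2
      _ = 2 ^ (2 * B) := by rw [two_mul, pow_add]

end Input

/-! ### The size of the linear programs -/

section Size

variable {A S P K : Type*} [Fintype S] [Field K]
  {G : Market A S P} {q : S → K} {t : G.Pair → K} {M : Finset (A × P)}
  {ratio : G.Pair → K} {lp : LinearProgram K G.Var}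

section Support

variable [LinearOrder K]

/-- A constraint that sums a fibre of a map on the pairs has one nonzero coefficient for each
pair of the fibre. -/
theorem card_support_fibre_le {κ : Type*} [DecidableEq κ] (g : G.Pair → κ) (k : κ) :
    (Finset.univ.filter fun v : G.Var =>
      v.elim (0 : K) (fun e => if g e = k then 1 else 0) ≠ 0).card ≤
      (Finset.univ.filter fun e => g e = k).card := by
  rw [← Finset.card_map (s := Finset.univ.filter fun e => g e = k) Function.Embedding.some]
  refine Finset.card_le_card fun v hv => ?_
  rw [Finset.mem_filter] at hv
  cases v with
  | none => simp at hv
  | some e =>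
    have : g e = k := by
      by_contra h
      exact hv.2 (by simp [h])
    simp [this]

theorem sum_card_support_fibre_le {κ : Type*} [Fintype κ] [DecidableEq κ] (g : G.Pair → κ) :
    ∑ k, (Finset.univ.filter fun v : G.Var =>
      v.elim (0 : K) (fun e => if g e = k then 1 else 0) ≠ 0).card ≤ Fintype.card G.Pair := by
  refine (Finset.sum_le_sum fun k _ => card_support_fibre_le g k).trans (le_of_eq ?_)
  rw [← Finset.card_univ, Finset.card_eq_sum_card_fiberwise fun e _ => Finset.mem_univ (g e)]

variable [DecidableEq S] [DecidableEq P]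

theorem card_support_pairConstraint_le (e : G.Pair) (c d : K) (rel : LPRel) (r : K) :
    (Finset.univ.filter fun v => (G.pairConstraint e c d rel r).coeff v ≠ 0).card ≤ 2 := by
  refine (Finset.card_le_card (t := {none, some e}) fun v hv => ?_).trans Finset.card_le_two
  rw [Finset.mem_filter] at hv
  cases v with
  | none => simp
  | some e' =>
    have : e' = e := by
      by_contra h
      exact hv.2 (by simp [pairConstraint, h])
    simp [this]

end Support

variable [Fintype P] [DecidableEq S] [DecidableEq P]

/-- All programs of a run have the same shape: the extra variable as objective, and one constraint
for each pair besides the funding constraints. -/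
theorem IsRunProgram.shape (h : G.IsRunProgram q t M ratio lp) :
    lp.objective = (fun v => v.elim 1 fun _ => 0) ∧
      ∃ f : G.Pair → LPConstraint K G.Var,
        lp.constraints = G.fundingConstraints q M ++ (Finset.univ : Finset G.Pair).toList.map f ∧
        ∀ e, ∃ d rel e', (d = 0 ∨ d = 1 ∨ d = -1) ∧
          (f e = G.pairConstraint e (1 / t e) d rel 0 ∨
            f e = G.pairConstraint e (1 / t e) d rel (ratio e')) := by
  cases h with
  | main level h =>
    refine ⟨rfl, _, rfl, fun e => ?_⟩
    cases hl : level e with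
    | none => exact ⟨-1, .le, e, by simp, Or.inl rfl⟩
    | some l => exact ⟨0, .eq, e, by simp, Or.inr (by rw [h e l hl])⟩
  | aux level e₁ e₀ h =>
    refine ⟨rfl, _, rfl, fun e => ?_⟩
    cases hl : level e with
    | none => exact ⟨if e = e₀ then 1 else 0, .le, e₁, by split_ifs <;> simp, Or.inr rfl⟩
    | some l => exact ⟨0, .eq, e, by simp, Or.inr (by rw [h e l hl])⟩

theorem length_fundingConstraints :
    (G.fundingConstraints q M).length =
      Fintype.card G.Pair + Fintype.card P + Fintype.card S := by
  simp only [fundingConstraints, List.length_append, List.length_map, Finset.length_toList,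
    Finset.card_univ]

variable [LinearOrder K]

theorem IsRunProgram.size_le (h : G.IsRunProgram q t M ratio lp) :
    lp.size ≤ 9 * Fintype.card G.Pair + Fintype.card P + Fintype.card S + 2 := by
  obtain ⟨hobj, f, hc, hf⟩ := h.shape
  have hobj' : (Finset.univ.filter fun v => lp.objective v ≠ 0).card ≤ 1 := by
    refine (Finset.card_le_card (t := {none}) fun v hv => ?_).trans (by simp)
    rw [Finset.mem_filter, hobj] at hv
    cases v with
    | none => simp
    | some e => simp at hv
  have hlen : lp.constraints.length =
      2 * Fintype.card G.Pair + Fintype.card P + Fintype.card S := by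
    rw [hc, List.length_append, length_fundingConstraints]
    simp
    omega
  have hpair : ∀ f : G.Pair → LPConstraint K G.Var,
      (∀ e, (Finset.univ.filter fun v => (f e).coeff v ≠ 0).card ≤ 2) →
      (((Finset.univ : Finset G.Pair).toList.map f).map fun c =>
        (Finset.univ.filter fun v => c.coeff v ≠ 0).card).sum ≤ 2 * Fintype.card G.Pair := by
    intro f hf
    rw [List.map_map, Finset.sum_map_toList]
    exact (Finset.sum_le_card_nsmul _ _ 2 fun e _ => hf e).trans (by simp [mul_comm])
  have h1 := hpair f fun e => by
    obtain ⟨d, rel, e', -, h | h⟩ := hf e <;> rw [h] <;> exact card_support_pairConstraint_le ..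
  have h2 : ((G.fundingConstraints q M).map fun c =>
      (Finset.univ.filter fun v => c.coeff v ≠ 0).card).sum ≤ 4 * Fintype.card G.Pair := by
    rw [fundingConstraints, List.map_append, List.map_append, List.sum_append, List.sum_append]
    have h3 := hpair (fun e => G.pairConstraint e 1 0 .ge 0) fun e =>
      card_support_pairConstraint_le ..
    have h4 := sum_card_support_fibre_le (K := K) fun e : G.Pair => e.2.1
    have h5 := sum_card_support_fibre_le (K := K) fun e : G.Pair => e.1
    rw [← Finset.sum_map_toList] at h4 h5
    rw [List.map_map (l := Finset.univ.toList (α := P)),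
      List.map_map (l := Finset.univ.toList (α := S))]
    refine (add_le_add (add_le_add h3 h4) h5).trans ?_
    omega
  have hcoeff : (lp.constraints.map fun c =>
      (Finset.univ.filter fun v => c.coeff v ≠ 0).card).sum ≤ 6 * Fintype.card G.Pair := by
    rw [hc, List.map_append, List.sum_append]
    omega
  unfold LinearProgram.size
  rw [hlen, Fintype.card_option]
  omega

end Size

section BitLength

variable {A S P : Type*} [Fintype S] [Fintype P] [DecidableEq S] [DecidableEq P]
  {G : Market A S P} {q : S → ℚ} {t : G.Pair → ℚ} {M : Finset (A × P)} {ratio : G.Pair → ℚ}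
  {lp : LinearProgram ℚ G.Var}

theorem IsRunProgram.bitLength_le (ht : ∀ e, 0 < t e) (h : G.IsRunProgram q t M ratio lp)
    {w : ℕ} (hw : 3 ≤ w) (hq : ∀ s, ratBits (q s) ≤ w) (hl : ∀ p, ratBits (load M p) ≤ w)
    (htw : ∀ e, ratBits (t e) ≤ w) (hr : ∀ e, ratBits (ratio e) ≤ w) :
    lp.bitLength ≤ 1 + (Fintype.card G.Pair + 1) * w +
      (2 * Fintype.card G.Pair + Fintype.card P + Fintype.card S) *
        (2 + (Fintype.card G.Pair + 1) * w + w) := by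
  obtain ⟨hobj, f, hc, hf⟩ := h.shape
  have h0 : ratBits 0 ≤ w := le_trans (by decide) hw
  have h1 : ratBits 1 ≤ w := le_trans (by decide) hw
  have hm1 : ratBits (-1) ≤ w := le_trans (by decide) hw
  have hlen : lp.constraints.length =
      2 * Fintype.card G.Pair + Fintype.card P + Fintype.card S := by
    rw [hc, List.length_append, length_fundingConstraints]
    simp
    omega
  have hpair : ∀ (e : G.Pair) (c d : ℚ) (rel : LPRel) (r : ℚ), ratBits c ≤ w → ratBits d ≤ w →
      ∀ v, ratBits ((G.pairConstraint e c d rel r).coeff v) ≤ w := by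
    intro e c d rel r hcw hdw v
    cases v with
    | none => exact hdw
    | some e' =>
      simp only [pairConstraint]
      split_ifs <;> assumption
  have hcon : ∀ c ∈ lp.constraints, (∀ v, ratBits (c.coeff v) ≤ w) ∧ ratBits c.rhs ≤ w := by
    rw [hc, fundingConstraints]
    simp only [List.forall_mem_append, List.forall_mem_map]
    refine ⟨⟨⟨fun e _ => ⟨hpair _ _ _ _ _ h1 h0, h0⟩, fun p _ => ⟨fun v => ?_, hl p⟩⟩,
      fun s _ => ⟨fun v => ?_, hq s⟩⟩, fun e _ => ?_⟩
    · cases v with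
      | none => exact h0
      | some e => simp only [Option.elim]; split_ifs <;> assumption
    · cases v with
      | none => exact h0
      | some e => simp only [Option.elim]; split_ifs <;> assumption
    · have hte : ratBits (1 / t e) ≤ w := (ratBits_one_div _ (ht e)).trans_le (htw e)
      obtain ⟨d, rel, e', hd, h⟩ := hf e
      have hd' : ratBits d ≤ w := by rcases hd with rfl | rfl | rfl <;> assumption
      rcases h with h | h <;> rw [h]
      · exact ⟨hpair _ _ _ _ _ hte hd', h0⟩
      · exact ⟨hpair _ _ _ _ _ hte hd', hr e'⟩
  have hsum : ∀ g : G.Var → ℚ, (∀ v, ratBits (g v) ≤ w) →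
      ∑ v, ratBits (g v) ≤ (Fintype.card G.Pair + 1) * w := by
    intro g hg
    exact (Finset.sum_le_card_nsmul _ _ w fun v _ => hg v).trans (by simp)
  have hobj' := hsum lp.objective fun v => by
    rw [hobj]
    cases v with
    | none => exact h1
    | some e => exact h0
  have hcs := List.sum_le_card_nsmul
    (lp.constraints.map fun c => 2 + ∑ v, ratBits (c.coeff v) + ratBits c.rhs)
    (2 + (Fintype.card G.Pair + 1) * w + w) (by
      simp only [List.forall_mem_map]
      intro c hcm
      have := hsum _ (hcon c hcm).1
      have := (hcon c hcm).2
      omega)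
  rw [List.length_map, hlen, smul_eq_mul] at hcs
  unfold LinearProgram.bitLength
  omega

end BitLength

end Market

/-! ### The theorem -/

namespace Market

theorem isEgalitarian_iff_eq {A S P : Type*} [Fintype S] [DecidableEq P] {G : Market A S P}
    {q : S → ℝ} {t : G.Pair → ℝ} {M : Finset (A × P)} {x : G.Pair → ℝ}
    (hx : G.IsFeasibleAllocation q M x)
    (hopt : ∀ y, G.IsFeasibleAllocation q M y →
      y = x ∨ List.Lex (· < ·) (G.ratioVector t x) (G.ratioVector t y)) (y : G.Pair → ℝ) :
    G.IsEgalitarian q t M y ↔ y = x := by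
  constructor
  · rintro ⟨hy, hle⟩
    rcases hopt y hy with h | h
    · exact h
    · rcases hle x hx with h' | h'
      · rw [h'] at h
        exact absurd h (irrefl (r := List.Lex (· < ·)) _)
      · exact absurd h (asymm (r := List.Lex (· < ·)) h')
  · rintro rfl
    exact ⟨hx, fun z hz => (hopt z hz).imp (fun h => by rw [h]) id⟩

theorem card_pair_le {A S P : Type*} [Fintype S] [Fintype P] (G : Market A S P) :
    Fintype.card G.Pair ≤ Fintype.card S * Fintype.card P := by
  rw [Fintype.card_sigma]
  exact (Finset.sum_le_card_nsmul _ _ (Fintype.card P) fun s _ => Fintype.card_subtype_le _).trans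
    (by simp)

theorem card_pair_mul_succ_le {A S P : Type*} [Fintype S] [Fintype P] (G : Market A S P) :
    Fintype.card G.Pair * (Fintype.card G.Pair + 1) ≤
      100 * (Fintype.card S ^ 2 * Fintype.card P ^ 2) := by
  have h := G.card_pair_le
  rw [← mul_pow]
  have h1 := Nat.mul_le_mul h (Nat.add_le_add_right h 1)
  have h2 := Nat.le_self_pow two_ne_zero (Fintype.card S * Fintype.card P)
  nlinarith

theorem size_le_of_mem_solved {A S P K : Type*} [Fintype S] [Fintype P] [DecidableEq S]
    [DecidableEq P] [Field K] [LinearOrder K] {G : Market A S P} {q : S → K} {t : G.Pair → K}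
    {M : Finset (A × P)} {ratio : G.Pair → K} {out : RunResult G K}
    (hlen : out.solved.length ≤ Fintype.card G.Pair * (Fintype.card G.Pair + 1))
    (hprog : ∀ lp ∈ out.solved, G.IsRunProgram q t M ratio lp) :
    ∀ lp ∈ out.solved, lp.size ≤ 14 * (Fintype.card S * Fintype.card P) := by
  intro lp hlp
  have h1 := (hprog lp hlp).size_le
  have h2 := G.card_pair_le
  -- a program has been solved, so there are pairs, and hence supervisors and projects
  have hT : 0 < Fintype.card G.Pair := by
    have := (List.length_pos_of_mem hlp).trans_le hlen
    exact Nat.pos_of_mul_pos_right this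
  obtain ⟨⟨s, p, hp⟩⟩ := Fintype.card_pos_iff.1 hT
  have hS : 0 < Fintype.card S := Fintype.card_pos_iff.2 ⟨s⟩
  have hP : 0 < Fintype.card P := Fintype.card_pos_iff.2 ⟨p⟩
  have h3 : Fintype.card S ≤ Fintype.card S * Fintype.card P := Nat.le_mul_of_pos_right _ hP
  have h4 : Fintype.card P ≤ Fintype.card S * Fintype.card P := Nat.le_mul_of_pos_left _ hS
  omega

/-- A bound on the binary lengths of the final ratios for an input of length `X`. -/
noncomputable def ratioBitsPoly : Polynomial ℕ := 14 * .X ^ 2 + 3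

/-- A bound on the binary length of each linear program of a run for an input of length `X`. -/
noncomputable def programBitsPoly : Polynomial ℕ :=
  1 + (.X + 1) * ratioBitsPoly + 2 * .X * (2 + (.X + 1) * ratioBitsPoly + ratioBitsPoly)

/-- A bound on the total running time in the bit model for an input of length `X`, when linear
programs of length `X` are solved in time `pLP`. -/
noncomputable def timePoly (pLP : Polynomial ℕ) : Polynomial ℕ :=
  .X * (.X + 1) * (programBitsPoly + pLP.comp programBitsPoly) + (2 * .X + 1) * (.X + 1) +
    .X * ((2 * .X + 1) * (.X + 1) + .X * (2 * (.X + 1) + ratioBitsPoly)) +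
    .X * ((.X + 1) + ratioBitsPoly * ratioBitsPoly)

end Market

theorem Polynomial.monotone_eval_nat (p : Polynomial ℕ) : Monotone fun n => p.eval n := by
  intro a b h
  simp only [Polynomial.eval_eq_sum_range]
  gcongr

theorem mainTheorem11 : ∃ C : ℕ,
    -- real data, unit-cost arithmetic, and an LP algorithm with running time at most `L (size)`
    (∀ (A S P : Type*) [Fintype A] [Fintype S] [Fintype P]
      [DecidableEq A] [DecidableEq S] [DecidableEq P]
      (G : Market A S P) (q : S → ℝ) (t : G.Pair → ℝ) (M : Finset (A × P)),
      G.IsMatching M → G.IsFeasible q M → G.IsTarget t →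
      ∀ (alg : LPAlgorithm ℝ G.Var) (L : ℕ → ℕ),
        Monotone L → (∀ n, n ≤ L n) → (∀ lp, alg.time lp ≤ L lp.size) →
        ∃ out, G.TerminatesWith (arithmeticModel ℝ G.Var) alg q t M out ∧
          (∀ x, G.IsEgalitarian q t M x ↔ x = out.allocation) ∧
          out.solved.length ≤ C * (Fintype.card S ^ 2 * Fintype.card P ^ 2) ∧
          (∀ lp ∈ out.solved, lp.size ≤ C * (Fintype.card S * Fintype.card P)) ∧
          (Nonempty S → Nonempty P →
            out.time ≤ C * (Fintype.card S ^ 2 * Fintype.card P ^ 2) *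
              L (C * (Fintype.card S * Fintype.card P)))) ∧
    -- rational data, bit model, and an LP algorithm that runs in polynomial time
    (∀ pLP : Polynomial ℕ, ∃ pAlg : Polynomial ℕ,
      ∀ (A S P : Type*) [Fintype A] [Fintype S] [Fintype P]
      [DecidableEq A] [DecidableEq S] [DecidableEq P]
      (G : Market A S P) (q : S → ℚ) (t : G.Pair → ℚ) (M : Finset (A × P)),
      G.IsMatching M → G.IsFeasible (fun s => (q s : ℝ)) M → G.IsTarget t →
      ∀ alg : LPAlgorithm ℚ G.Var, (∀ lp, alg.time lp ≤ pLP.eval lp.bitLength) →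
        ∃ out, G.TerminatesWith (bitModel G.Var) alg q t M out ∧
          (∀ x : G.Pair → ℝ, G.IsEgalitarian (fun s => (q s : ℝ)) (fun e => (t e : ℝ)) M x ↔
            x = fun e => (out.allocation e : ℝ)) ∧
          out.solved.length ≤ C * (Fintype.card S ^ 2 * Fintype.card P ^ 2) ∧
          (∀ lp ∈ out.solved, lp.size ≤ C * (Fintype.card S * Fintype.card P)) ∧
          out.time ≤ pAlg.eval (G.inputBits q t M)) := by
  -- with `m = |S| |P|`, at most `2 m²` programs of size at most `14 m` are solved, and the
  -- bookkeeping takes at most `11 m²` steps in the arithmetic model; `100` leaves ample room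
  refine ⟨100, ?_, fun pLP => ⟨Market.timePoly pLP, ?_⟩⟩
  · intro A S P _ _ _ _ _ _ G q t M _ hf ht alg L hL hnL htime
    obtain ⟨out, ratio, hterm, -, hfeas, hopt, hlen, hprog, hcost⟩ :=
      G.exists_terminatesWith (arithmeticModel ℝ G.Var) alg q t M (φ := RingHom.id ℝ)
        strictMono_id ht.pos hf
    have hsize := Market.size_le_of_mem_solved hlen hprog
    refine ⟨out, hterm, Market.isEgalitarian_iff_eq hfeas hopt,
      hlen.trans G.card_pair_mul_succ_le, fun lp hlp => (hsize lp hlp).trans (by omega), ?_⟩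
    intro hS hP
    have hm : 0 < Fintype.card S * Fintype.card P :=
      Nat.mul_pos Fintype.card_pos Fintype.card_pos
    have hN := G.card_pair_le
    have hc := hcost 1 1 (fun _ => le_rfl) fun _ => le_rfl
    simp only [arithmeticModel] at hc
    rw [← mul_pow]
    set m := Fintype.card S * Fintype.card P
    set N := Fintype.card G.Pair
    set l := L (100 * m) with hl
    have hml : 100 * m ≤ l := hnL _
    have hsum := List.sum_le_card_nsmul
      (out.solved.map (Market.callCost (arithmeticModel ℝ G.Var) alg)) (2 * l) (by
        simp only [List.forall_mem_map]
        intro lp hlp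
        have h1 := hsize lp hlp
        have h2 := htime lp
        have h3 : L lp.size ≤ l := hL (h1.trans (by omega))
        have h4 : Market.callCost (arithmeticModel ℝ G.Var) alg lp = lp.size + alg.time lp := rfl
        omega)
    rw [List.length_map, smul_eq_mul] at hsum
    simp only [arithmeticModel] at hsum
    have h1 : N * (N + 1) ≤ 2 * m ^ 2 := by nlinarith
    have h2 : out.solved.length * (2 * l) ≤ 2 * m ^ 2 * (2 * l) :=
      Nat.mul_le_mul_right _ (hlen.trans h1)
    have h3 : (2 * N + 1) * 1 + N * ((2 * N + 1) * 1 + N * (2 * 1 + 1)) + N * (1 + 1 * 1) ≤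
        11 * m ^ 2 := by nlinarith
    have h4 : 11 * m ^ 2 ≤ 11 * m ^ 2 * l := Nat.le_mul_of_pos_right _ (by omega)
    have h5 : 2 * m ^ 2 * (2 * l) + 11 * m ^ 2 * l ≤ 100 * m ^ 2 * l := by
      have : 0 ≤ m ^ 2 * l := Nat.zero_le _
      nlinarith
    omega
  · intro A S P _ _ _ _ _ _ G q t M _ hf ht alg htime
    have hφ : StrictMono (Rat.castHom ℝ) := Rat.cast_strictMono
    obtain ⟨out, ratio, hterm, halloc, hfeas, hopt, hlen, hprog, hcost⟩ :=
      G.exists_terminatesWith (bitModel G.Var) alg q t M (φ := Rat.castHom ℝ) hφ ht.pos hf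
    have hsize := Market.size_le_of_mem_solved hlen hprog
    refine ⟨out, hterm, Market.isEgalitarian_iff_eq hfeas hopt,
      hlen.trans G.card_pair_mul_succ_le, fun lp hlp => (hsize lp hlp).trans (by omega), ?_⟩
    rw [halloc] at hfeas hopt
    have hratio := G.ratBits_ratio_le q t M ht.pos ratio hfeas hopt
    have hcard := G.card_add_card_le_inputBits q t M
    have hq := G.ratBits_budget_le_inputBits q t M
    have hl := G.ratBits_load_le_inputBits q t M
    have htb := G.ratBits_target_le_inputBits q t M
    set B := G.inputBits q t M
    set w := 14 * B ^ 2 + 3 with hw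
    have hBw : B ≤ w := by nlinarith
    have hc := hcost w w hratio fun e => (htb e).trans hBw
    have hN : Fintype.card G.Pair ≤ B := by omega
    have hindex : (bitModel G.Var).index ≤ B + 1 := by
      have h1 : Nat.size (Fintype.card G.Var) ≤ Fintype.card G.Var :=
        Nat.size_le.2 Nat.lt_two_pow_self
      exact h1.trans (Fintype.card_option.trans_le (Nat.add_le_add_right hN 1))
    set b := 1 + (B + 1) * w + 2 * B * (2 + (B + 1) * w + w) with hb
    have hbits : ∀ lp ∈ out.solved, lp.bitLength ≤ b := by
      intro lp hlp
      refine ((hprog lp hlp).bitLength_le ht.pos (by omega) (fun s => (hq s).trans hBw)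
        (fun p => (hl p).trans hBw) (fun e => (htb e).trans hBw) hratio).trans ?_
      have : 2 * Fintype.card G.Pair + Fintype.card P + Fintype.card S ≤ 2 * B := by omega
      rw [hb]
      gcongr
    have hsum := List.sum_le_card_nsmul
      (out.solved.map (Market.callCost (bitModel G.Var) alg)) (b + pLP.eval b) (by
        simp only [List.forall_mem_map]
        intro lp hlp
        exact Nat.add_le_add (hbits lp hlp)
          ((htime lp).trans (pLP.monotone_eval_nat (hbits lp hlp))))
    rw [List.length_map, smul_eq_mul] at hsum
    have hsum' : (out.solved.map (Market.callCost (bitModel G.Var) alg)).sum ≤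
        B * (B + 1) * (b + pLP.eval b) :=
      hsum.trans (Nat.mul_le_mul_right _ (hlen.trans (Nat.mul_le_mul hN (by omega))))
    have hpoly : (Market.timePoly pLP).eval B = B * (B + 1) * (b + pLP.eval b) +
        (2 * B + 1) * (B + 1) + B * ((2 * B + 1) * (B + 1) + B * (2 * (B + 1) + w)) +
        B * ((B + 1) + w * w) := by
      simp [Market.timePoly, Market.programBitsPoly, Market.ratioBitsPoly, Polynomial.eval_comp,
        hb, hw]
    rw [hpoly]
    refine hc.trans ?_
    gcongr
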